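/- **Formula-satisfying game.** An instance $\mathcal F=(\tau,F_R,F_C,\alpha)$ consists of finite disjoint sets of variables $C,R$, a player $\tau\in\{\mathrm I,\mathrm{II}\}$ who is to move, two formulas $F_R,F_C$ over $C\cup R$ in 12-DNF (finite disjunctions of clauses, each clause a conjunction of at most 12 literals) and an assignment $\alpha:C\cup R\to\{0,1\}$. Player I, to move at an assignment under which $F_C$ is false, changes the value of at most one variable in $R$; player II, to move at an assignment under which $F_R$ is false, changes the value of at most one variable in $C$. The players alternate. A player to move who has no legal move (the opponent's formula is true) has lost; player I wins $\mathcal F$ if he can force this for player II in finitely many moves (an infinite play is not a win for player I). **Guarding game with prescribed starting positions.** $\mathcal G=(\vec G,V_C,c,S,r)$ consists of a finite directed graph $\vec G$, a cop-region $V_C\subset V(\vec G)$ with robber-region $V_R=V(\vec G)\setminus V_C$, a number $c$ of cops, their starting positions $S:\{1,\dots,c\}\to V_C$ and Robber's starting vertex $r\in V_R$. Robber moves first, then the players alternate. Robber stays or moves along an edge, to a vertex with no cop on it; in a turn of the cops every cop stays or moves along an edge within $V_C$. The robber-player wins if he can force Robber into $V_C$ in finitely many turns. **Sizes.** $|\mathcal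 F|$ and $|\mathcal G|$ are lengths in bits of binary encodings: $\mathcal F$ is encoded by $\tau$, the values of $\alpha$ and the lists of clauses as lists of literals, with variable names of $\lceil\log_2(|C|+|R|)\rceil$ bits; $\mathcal G$ is encoded by the adjacency lists of $\vec G$, the membership of every vertex in $V_C$, the list $S$ and $r$, with vertex names of $\lceil\log_2|V(\vec G)|\rceil$ bits. All lists are self-delimiting (one bit before each item and one at the end). **The game $\mathcal G(\mathcal F)$.** The graph is put together from the following gadgets; vertices of the same name are identified. Write $S_2=\{RM,RT,CM,RW,CT\}\cup\{Sw_y: y\in R\}\subseteq V_R$ and $S_1=S_2\setminus\{CT\}$. For $u\in S_2$ and $X\subseteq V_C$, $\mathrm{BLOCK}(u,X)$ consists of new vertices $p\in V_R$, $q\in V_C$ and the edges $(u,p)$, $(p,q)$ and $(s,q)$ for $s\in X$. For $U\subseteq S_2$ and $X\subseteq V_C$, $\mathrm{FORCE}(U,X)$ consists of a new vertex $f\in V_R$ and new vertices $\bar v\in V_R$ $(v\in X)$ with the edges $(u,f)$ for $u\in U$ and $(f,\bar v),(\bar v,v)$ for $v\in X$. 1. The directed cycle $(RM,RT,CM,RW,CT)$,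 and for every $y\in R$ the edges $(RM,Sw_y),(Sw_y,RT)$. 2. For every variable $x$ a directed cycle $(T_x,FT_x,F_x,TF_x)$ in $V_C$. 3. For every clause $\varphi$ of $F_R$ the gadget $\mathrm{BLOCK}(RT,\{T_x:\neg x\in\varphi\}\cup\{F_x: x\in\varphi\})$; its vertex $q$ is called $z_\varphi$. 4. A vertex $a''\in V_C$ with edges to all $z_\varphi$; for every clause $\psi$ of $F_C$ a directed cycle $(a_\psi,a'_\psi,a'',a'''_\psi)$ in $V_C$ and, for every literal $\ell$ of $\psi$, the gadget $\mathrm{BLOCK}(CT,\{t_\ell,a_\psi,a''\})$, where $t_\ell=T_x$ if $\ell=x$ and $t_\ell=F_x$ if $\ell=\neg x$. 5. A vertex $HQ\in V_C$ and for every variable $x$ vertices $G_x,GT_x,GF_x\in V_C$ with the edges $(HQ,G_x),(G_x,HQ),(G_x,GT_x),(GT_x,T_x),(G_x,GF_x),(GF_x,F_x)$. 6. For every $y\in R$ the gadgets $\mathrm{BLOCK}(Sw_y,\{FT_y,TF_y\})$ and $\mathrm{BLOCK}(Sw_y,\{G_y\})$; further $\mathrm{BLOCK}(CM,\{HQ\}\cup\{G_x:x\in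 C\})$ and, for $u\in\{RM,RT,RW,CT\}$, $\mathrm{BLOCK}(u,\{HQ\})$. 7. $\mathrm{FORCE}(S_2,\{T_x\}_{x})$, $\mathrm{FORCE}(S_2,\{F_x\}_{x})$, $\mathrm{FORCE}(S_1,\{a_\psi\}_{\psi})$ and $\mathrm{FORCE}(S_1,\{a''\})$, where the edge $(f,\overline{a''})$ of the last one is omitted if $F_C$ has no clause. 8. A vertex $r\in V_R$ with one edge, to $CT$ if $\tau=\mathrm I$ and to $RT$ if $\tau=\mathrm{II}$. Robber starts on $r$. There are $c=|C\cup R|+|F_C|+1$ cops ($|F_C|$ the number of clauses): for each variable $x$ one cop starts on $T_x$ if $\alpha(x)=1$ and on $F_x$ otherwise, for each clause $\psi$ of $F_C$ one cop starts on $a_\psi$, and one cop starts on $HQ$. **Theorem.** There is a constant $K$ such that for every instance $\mathcal F$ of the formula-satisfying game, the guarding game $\mathcal G=\mathcal G(\mathcal F)=(\vec G,V_C,c,S,r)$ with prescribed starting positions has the following properties. Player I wins $\mathcal F$ if and only if the robber-player wins $\mathcal G$. Moreover: 1. $|\mathcal G|\le K\,|\mathcal F|\log_2|\mathcal F|$,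 for every numbering of the vertices of $\vec G$. 2. No edge of $\vec G$ ends in $r$. 3. $S$ is injective, that is, at most one cop starts at each vertex. 4. Every vertex of the border $B=\{u\in V_R:\exists v\in V_C,\ (u,v)\in E(\vec G)\}$ has out-degree exactly $1$. -/

import Mathlib

/-! ### Self-delimiting binary encodings -/

/-- The `w` lowest binary digits of `k`. -/
def fixedBits (w k : ℕ) : List Bool := List.ofFn fun i : Fin w => k.testBit i

/-- Encoding of a list: every item is preceded by the bit `1`, and the list ends with the bit `0`. -/
def encodeListWith {α : Type} (enc : α → List Bool) (l : List α) : List Bool :=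
  l.flatMap (fun a => true :: enc a) ++ [false]

/-! ### The guarding game with prescribed starting positions -/

/-- A guarding game `(G, V_C, c, S, r)` on a finite directed graph with prescribed starting
positions. The robber-region is the complement of `copRegion`. -/
structure GuardingGame where
  V : Type
  [fintypeV : Fintype V]
  graph : Digraph V
  copRegion : Set V
  c : ℕ
  S : Fin c → V
  r : V
  S_mem : ∀ i, S i ∈ copRegion
  r_mem : r ∉ copRegion

namespace GuardingGame

attribute [instance] GuardingGame.fintypeV

variable (𝒢 : GuardingGame)

/-- Robber, standing on `u`, stays or moves along an edge, to a vertex `u'` with no cop on it;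
the cops stand at `s`. -/
def RobberMove (s : Fin 𝒢.c → 𝒢.V) (u u' : 𝒢.V) : Prop :=
  (u' = u ∨ 𝒢.graph.Adj u u') ∧ ∀ i, s i ≠ u'

/-- Every cop stays or moves along an edge, inside the cop-region. -/
def CopMove (s s' : Fin 𝒢.c → 𝒢.V) : Prop :=
  ∀ i, (s' i = s i ∨ 𝒢.graph.Adj (s i) (s' i)) ∧ s' i ∈ 𝒢.copRegion

/-- Robber stands on `u`, the cops stand at `s`, it is Robber's turn, and the robber-player can
force Robber to enter the cop-region after finitely many turns. -/
inductive RobberWinsFrom : 𝒢.V → (Fin 𝒢.c → 𝒢.V) → Prop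
  | enter (u u' : 𝒢.V) (s : Fin 𝒢.c → 𝒢.V) :
      𝒢.RobberMove s u u' → u' ∈ 𝒢.copRegion → RobberWinsFrom u s
  | step (u u' : 𝒢.V) (s : Fin 𝒢.c → 𝒢.V) :
      𝒢.RobberMove s u u' → u' ∉ 𝒢.copRegion →
      (∀ s', 𝒢.CopMove s s' → RobberWinsFrom u' s') → RobberWinsFrom u s

/-- The robber-player wins from the prescribed starting positions (Robber is to move). -/
def RobberWins : Prop := 𝒢.RobberWinsFrom 𝒢.r 𝒢.S

/-- The border vertices: vertices of the robber-region with an edge into the cop-region. -/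
def border : Set 𝒢.V := {u | u ∉ 𝒢.copRegion ∧ ∃ v ∈ 𝒢.copRegion, 𝒢.graph.Adj u v}

/-- The out-degree of a vertex. -/
noncomputable def outDegree (u : 𝒢.V) : ℕ := Set.ncard {v | 𝒢.graph.Adj u v}

/-- Number of bits of a vertex name. -/
def nameWidth : ℕ := Nat.clog 2 (Fintype.card 𝒢.V)

open Classical in
/-- Binary encoding of the game with respect to a numbering `e` of the vertices: for every vertex,
one bit for membership in the cop-region and the list of its out-neighbours; then the list of the
starting positions of the cops; then the starting position of Robber. -/
noncomputable def encode (e : 𝒢.V ≃ Fin (Fintype.card 𝒢.V)) : List Bool :=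
  encodeListWith
      (fun i => decide (e.symm i ∈ 𝒢.copRegion) ::
        encodeListWith (fun j : Fin (Fintype.card 𝒢.V) => fixedBits 𝒢.nameWidth j)
          ((List.finRange (Fintype.card 𝒢.V)).filter
            fun j => decide (𝒢.graph.Adj (e.symm i) (e.symm j))))
      (List.finRange (Fintype.card 𝒢.V)) ++
    encodeListWith (fun k => fixedBits 𝒢.nameWidth (e (𝒢.S k))) (List.finRange 𝒢.c) ++
    fixedBits 𝒢.nameWidth (e 𝒢.r)

end GuardingGame

/-! ### The formula-satisfying game -/

/-- The two players. -/
inductive Player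
  | I
  | II

/-- A position `(τ, F_R, F_C, α)` of the formula-satisfying game. The variables are the disjoint
union of `C` (with `nC` elements, left summand) and `R` (with `nR` elements, right summand). A
literal is a variable with the value that makes the literal true; a clause is a conjunction of at
most 12 literals; a formula is a disjunction of clauses. -/
structure FormulaGame where
  nC : ℕ
  nR : ℕ
  τ : Player
  FR : List (List ((Fin nC ⊕ Fin nR) × Bool))
  FC : List (List ((Fin nC ⊕ Fin nR) × Bool))
  FR_le : ∀ φ ∈ FR, φ.length ≤ 12
  FC_le : ∀ ψ ∈ FC, ψ.length ≤ 12
  α : Fin nC ⊕ Fin nR → Bool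

namespace FormulaGame

variable (ℱ : FormulaGame)

/-- The variables of the game. -/
abbrev Var : Type := Fin ℱ.nC ⊕ Fin ℱ.nR

/-- Truth of a formula in disjunctive normal form under an assignment. -/
def Holds (Φ : List (List (ℱ.Var × Bool))) (β : ℱ.Var → Bool) : Prop :=
  ∃ φ ∈ Φ, ∀ l ∈ φ, β l.1 = l.2

/-- The legal moves. Player I changes at most one variable of `R`, provided that `F_C` is false;
player II changes at most one variable of `C`, provided that `F_R` is false. -/
inductive Move : Player × (ℱ.Var → Bool) → Player × (ℱ.Var → Bool) → Prop
  | one (β β' : ℱ.Var → Bool) : ¬ ℱ.Holds ℱ.FC β → (∀ x, β' (.inl x) = β (.inl x)) →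
      {y | β' (.inr y) ≠ β (.inr y)}.Subsingleton → Move (.I, β) (.II, β')
  | two (β β' : ℱ.Var → Bool) : ¬ ℱ.Holds ℱ.FR β → (∀ y, β' (.inr y) = β (.inr y)) →
      {x | β' (.inl x) ≠ β (.inl x)}.Subsingleton → Move (.II, β) (.I, β')

/-- Player I can force a win in finitely many moves; a player who cannot move has lost, because
the formula of the opponent is true. -/
inductive WinsI : Player × (ℱ.Var → Bool) → Prop
  | one (β : ℱ.Var → Bool) (q : Player × (ℱ.Var → Bool)) :
      ℱ.Move (.I, β) q → WinsI q → WinsI (.I, β)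
  | two (β : ℱ.Var → Bool) : (∀ q, ℱ.Move (.II, β) q → WinsI q) → WinsI (.II, β)

/-- Player I wins the given instance. -/
def PlayerIWins : Prop := ℱ.WinsI (ℱ.τ, ℱ.α)

/-- Encoding of a literal: its sign and the name of its variable. -/
def encodeLiteral (l : ℱ.Var × Bool) : List Bool :=
  l.2 :: fixedBits (Nat.clog 2 (ℱ.nC + ℱ.nR)) (finSumFinEquiv l.1)

/-- Binary encoding of the instance: the player to move, the assignment on `C` and on `R`, and the
two formulas. -/
def encode : List Bool :=
  (match ℱ.τ with | .I => false | .II => true) ::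
    (encodeListWith (fun x => [ℱ.α (.inl x)]) (List.finRange ℱ.nC) ++
      encodeListWith (fun y => [ℱ.α (.inr y)]) (List.finRange ℱ.nR) ++
      encodeListWith (encodeListWith ℱ.encodeLiteral) ℱ.FR ++
      encodeListWith (encodeListWith ℱ.encodeLiteral) ℱ.FC)

/-! ### The guarding game constructed from a formula-satisfying game -/

/-- The normal positions of Robber: the Basic Cycle and the vertices `Sw_y` for `y ∈ R`. -/
inductive Station
  | RM
  | RT
  | CM
  | RW
  | CT
  | Sw (y : Fin ℱ.nR)
  deriving DecidableEq, Fintype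

/-- Names of the Blocker gadgets. -/
inductive Blocker
  /-- the Robber Gate of a clause `φ` of `F_R` -/
  | robberGate (φ : Fin ℱ.FR.length)
  /-- the blocker of the `i`-th literal in the Cop Gate of a clause `ψ` of `F_C` -/
  | copGate (ψ : Fin ℱ.FC.length) (i : Fin (ℱ.FC.get ψ).length)
  /-- the blocker of the Robber Switch of `y ∈ R` -/
  | robberSwitch (y : Fin ℱ.nR)
  /-- the blocker that controls Commander while Robber is on a given normal position -/
  | command (s : ℱ.Station)
  deriving DecidableEq, Fintype

/-- The vertices of the constructed graph. -/
inductive Vertex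
  /-- the starting vertex of Robber -/
  | start
  | station (s : ℱ.Station)
  /-- the vertices `p` and `q` of a Blocker -/
  | p (b : ℱ.Blocker)
  | q (b : ℱ.Blocker)
  /-- the forcing vertices, and for every forced vertex `v` the vertex `v̄` -/
  | forceT
  | forceF
  | forceA
  | forceA''
  | barT (x : ℱ.Var)
  | barF (x : ℱ.Var)
  | barA (ψ : Fin ℱ.FC.length)
  | barA''
  /-- the Variable Cells -/
  | T (x : ℱ.Var)
  | FT (x : ℱ.Var)
  | F (x : ℱ.Var)
  | TF (x : ℱ.Var)
  /-- the cycles of the Cop Gates; `a''` is shared by all clauses -/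
  | a (ψ : Fin ℱ.FC.length)
  | a' (ψ : Fin ℱ.FC.length)
  | a''
  | a''' (ψ : Fin ℱ.FC.length)
  /-- the Commander gadget -/
  | HQ
  | G (x : ℱ.Var)
  | GT (x : ℱ.Var)
  | GF (x : ℱ.Var)
  deriving DecidableEq, Fintype

variable {ℱ}

/-- The cop-region of the constructed game. -/
def Vertex.InCopRegion : ℱ.Vertex → Prop
  | .q _ | .T _ | .FT _ | .F _ | .TF _ | .a _ | .a' _ | .a'' | .a''' _
  | .HQ | .G _ | .GT _ | .GF _ => True
  | _ => False

/-- The vertex of the Variable Cell of `x` that represents the value `b`. -/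
def Vertex.value (x : ℱ.Var) (b : Bool) : ℱ.Vertex := if b then .T x else .F x

/-- The vertex `u` of a Blocker `BLOCK(u, S)`. -/
def Blocker.source : ℱ.Blocker → ℱ.Station
  | .robberGate _ => .RT
  | .copGate _ _ => .CT
  | .robberSwitch y => .Sw y
  | .command s => s

/-- The set `S` of a Blocker `BLOCK(u, S)`. -/
def Blocker.blocked : ℱ.Blocker → Set ℱ.Vertex
  | .robberGate φ => {v | ∃ l ∈ ℱ.FR.get φ, v = .value l.1 (!l.2)}
  | .copGate ψ i =>
      {.value ((ℱ.FC.get ψ).get i).1 ((ℱ.FC.get ψ).get i).2, .a ψ, .a''}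
  | .robberSwitch y => {.FT (.inr y), .TF (.inr y)}
  | .command (.Sw y) => {.G (.inr y)}
  | .command .CM => {v | v = .HQ ∨ ∃ x : Fin ℱ.nC, v = .G (.inl x)}
  | .command _ => {.HQ}

variable (ℱ)

/-- The edges of the constructed graph. -/
inductive Edge : ℱ.Vertex → ℱ.Vertex → Prop
  /-- Robber's first move leads to the test of the formula of the player who is not to move. -/
  | start_CT : ℱ.τ = .I → Edge .start (.station .CT)
  | start_RT : ℱ.τ = .II → Edge .start (.station .RT)
  /-- Basic Cycle -/
  | RM_RT : Edge (.station .RM) (.station .RT)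
  | RT_CM : Edge (.station .RT) (.station .CM)
  | CM_RW : Edge (.station .CM) (.station .RW)
  | RW_CT : Edge (.station .RW) (.station .CT)
  | CT_RM : Edge (.station .CT) (.station .RM)
  /-- Robber Switches -/
  | RM_Sw (y : Fin ℱ.nR) : Edge (.station .RM) (.station (.Sw y))
  | Sw_RT (y : Fin ℱ.nR) : Edge (.station (.Sw y)) (.station .RT)
  /-- Blockers -/
  | source_p (b : ℱ.Blocker) : Edge (.station b.source) (.p b)
  | p_q (b : ℱ.Blocker) : Edge (.p b) (.q b)
  | blocked_q (b : ℱ.Blocker) (v : ℱ.Vertex) : v ∈ b.blocked → Edge v (.q b)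
  /-- Enforcer gadgets -/
  | station_forceT (s : ℱ.Station) : Edge (.station s) .forceT
  | station_forceF (s : ℱ.Station) : Edge (.station s) .forceF
  | station_forceA (s : ℱ.Station) : s ≠ .CT → Edge (.station s) .forceA
  | station_forceA'' (s : ℱ.Station) : s ≠ .CT → Edge (.station s) .forceA''
  | forceT_barT (x : ℱ.Var) : Edge .forceT (.barT x)
  | forceF_barF (x : ℱ.Var) : Edge .forceF (.barF x)
  | forceA_barA (ψ : Fin ℱ.FC.length) : Edge .forceA (.barA ψ)
  | forceA''_barA'' : ℱ.FC ≠ [] → Edge .forceA'' .barA''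
  | barT_T (x : ℱ.Var) : Edge (.barT x) (.T x)
  | barF_F (x : ℱ.Var) : Edge (.barF x) (.F x)
  | barA_a (ψ : Fin ℱ.FC.length) : Edge (.barA ψ) (.a ψ)
  | barA''_a'' : Edge .barA'' .a''
  /-- Variable Cells -/
  | T_FT (x : ℱ.Var) : Edge (.T x) (.FT x)
  | FT_F (x : ℱ.Var) : Edge (.FT x) (.F x)
  | F_TF (x : ℱ.Var) : Edge (.F x) (.TF x)
  | TF_T (x : ℱ.Var) : Edge (.TF x) (.T x)
  /-- Cop Gates -/
  | a_a' (ψ : Fin ℱ.FC.length) : Edge (.a ψ) (.a' ψ)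
  | a'_a'' (ψ : Fin ℱ.FC.length) : Edge (.a' ψ) .a''
  | a''_a''' (ψ : Fin ℱ.FC.length) : Edge .a'' (.a''' ψ)
  | a'''_a (ψ : Fin ℱ.FC.length) : Edge (.a''' ψ) (.a ψ)
  | a''_z (φ : Fin ℱ.FR.length) : Edge .a'' (.q (.robberGate φ))
  /-- Commander gadget -/
  | HQ_G (x : ℱ.Var) : Edge .HQ (.G x)
  | G_HQ (x : ℱ.Var) : Edge (.G x) .HQ
  | G_GT (x : ℱ.Var) : Edge (.G x) (.GT x)
  | GT_T (x : ℱ.Var) : Edge (.GT x) (.T x)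
  | G_GF (x : ℱ.Var) : Edge (.G x) (.GF x)
  | GF_F (x : ℱ.Var) : Edge (.GF x) (.F x)

/-- Starting positions of the cops: one variable cop for every variable of `C` and of `R`, one cop
for every clause of `F_C`, and Commander. -/
def copStart : Fin (ℱ.nC + ℱ.nR + ℱ.FC.length + 1) → ℱ.Vertex :=
  Fin.append
    (Fin.append
      (Fin.append (fun x => .value (.inl x) (ℱ.α (.inl x)))
        (fun y => .value (.inr y) (ℱ.α (.inr y))))
      (fun ψ => .a ψ))
    (fun _ => .HQ)

theorem copStart_inCopRegion (i : Fin (ℱ.nC + ℱ.nR + ℱ.FC.length + 1)) :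
    (ℱ.copStart i).InCopRegion := by
  have hv : ∀ (x : ℱ.Var) (b : Bool), (Vertex.value x b).InCopRegion := by
    intro x b
    cases b <;> exact trivial
  unfold copStart
  refine Fin.addCases (fun i => ?_) (fun i => ?_) i
  · rw [Fin.append_left]
    refine Fin.addCases (fun i => ?_) (fun i => ?_) i
    · rw [Fin.append_left]
      refine Fin.addCases (fun i => ?_) (fun i => ?_) i
      · rw [Fin.append_left]
        exact hv _ _
      · rw [Fin.append_right]
        exact hv _ _
    · rw [Fin.append_right]
      exact trivial
  · rw [Fin.append_right]
    exact trivial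

/-- The guarding game with prescribed starting positions constructed from `ℱ`. -/
def toGuardingGame : GuardingGame where
  V := ℱ.Vertex
  graph := ⟨ℱ.Edge⟩
  copRegion := {v | v.InCopRegion}
  c := ℱ.nC + ℱ.nR + ℱ.FC.length + 1
  S := ℱ.copStart
  r := .start
  S_mem := ℱ.copStart_inCopRegion
  r_mem := fun h => h

end FormulaGame

/-!
The cops that represent the assignment are held in place by two kinds of threats. A blocker whose
vertex `q` nobody can reach in one step lets Robber in at once, and so does an enforcer if some
target cannot be reached in two steps. The command blockers dictate where Commander is, and then the
enforcers forbid a variable cop to be between two values, except at the single variable where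
Commander stands in for him. Hence Robber, going around the Basic Cycle, makes the cops play the
formula-satisfying game: on the way through a vertex `Sw y` he changes the variable `y`, and while
he is on `CM` the cops may change one variable of `C`. At `RT` a true formula `F_R` leaves some
robber gate open; at `CT` a clause cop that has set out for `a''` leaves some cop gate open, unless
`F_C` is true.

Conversely, if player I does not win, then the cops follow a strategy of player II. When `F_C`
becomes true, the cop of a true clause `ψ` leaves `a ψ` while Robber is on `CT`: the literals of `ψ`
guard the gates in his place, and one turn later he is on `a''`, from where he replaces all clause
cops and guards all robber gates for ever.

For the size, an edge of the graph is listed with that of its ends at which the number of such edges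
is bounded, so the number of edges is linear in the number of vertices, and both are linear in the
size of the formula game.
-/

/-! ### Winning positions of a guarding game -/

namespace GuardingGame

variable {𝒢 : GuardingGame} {ι : Type*} {e : Fin 𝒢.c ≃ ι} {u v w : 𝒢.V} {σ : ι → 𝒢.V}

variable (𝒢) in
/-- A legal step of a single cop. -/
def CopStep (u v : 𝒢.V) : Prop :=
  (v = u ∨ 𝒢.graph.Adj u v) ∧ v ∈ 𝒢.copRegion

variable (e) in
/-- The robber-player wins with Robber on `u` and to move, and the cops at `σ`. The bijection `e`
replaces the numbers of the cops by names in `ι`. -/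
def RobberWinsAt (u : 𝒢.V) (σ : ι → 𝒢.V) : Prop :=
  𝒢.RobberWinsFrom u (σ ∘ e)

theorem copMove_comp_iff {σ' : ι → 𝒢.V} :
    𝒢.CopMove (σ ∘ e) (σ' ∘ e) ↔ ∀ k, 𝒢.CopStep (σ k) (σ' k) :=
  e.forall_congr fun _ => Iff.rfl

theorem RobberWinsAt.of_enter (huv : 𝒢.graph.Adj u v) (hv : v ∈ 𝒢.copRegion)
    (hσ : ∀ k, σ k ≠ v) : RobberWinsAt e u σ :=
  .enter u v _ ⟨.inr huv, fun i => hσ (e i)⟩ hv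

theorem RobberWinsAt.of_step (huv : 𝒢.graph.Adj u v) (hv : v ∉ 𝒢.copRegion)
    (hσ : ∀ k, σ k ∈ 𝒢.copRegion)
    (h : ∀ σ' : ι → 𝒢.V, (∀ k, 𝒢.CopStep (σ k) (σ' k)) → RobberWinsAt e v σ') :
    RobberWinsAt e u σ := by
  refine .step u v _ ⟨.inr huv, fun i hi => hv (hi ▸ hσ (e i))⟩ hv fun s' hs' => ?_
  obtain ⟨σ', rfl⟩ : ∃ σ' : ι → 𝒢.V, σ' ∘ e = s' := ⟨s' ∘ e.symm, by ext i; simp⟩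
  exact h σ' (copMove_comp_iff.1 hs')

theorem exists_copStep_of_not_robberWinsAt (hσ : ∀ k, σ k ∈ 𝒢.copRegion)
    (h : ¬ RobberWinsAt e u σ) (huv : 𝒢.graph.Adj u v) (hv : v ∉ 𝒢.copRegion)
    (hvw : 𝒢.graph.Adj v w) (hw : w ∈ 𝒢.copRegion) : ∃ k, 𝒢.CopStep (σ k) w := by
  contrapose! h
  exact .of_step huv hv hσ fun σ' hm => .of_enter hvw hw fun k hk => h k (hk ▸ hm k)

theorem exists_copStep_copStep_of_not_robberWinsAt {x : 𝒢.V} (hσ : ∀ k, σ k ∈ 𝒢.copRegion)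
    (h : ¬ RobberWinsAt e u σ) (huv : 𝒢.graph.Adj u v) (hv : v ∉ 𝒢.copRegion)
    (hvw : 𝒢.graph.Adj v w) (hw : w ∉ 𝒢.copRegion) (hwx : 𝒢.graph.Adj w x)
    (hx : x ∈ 𝒢.copRegion) : ∃ k m, 𝒢.CopStep (σ k) m ∧ 𝒢.CopStep m x := by
  contrapose! h
  refine .of_step huv hv hσ fun σ' hm => ?_
  by_contra hσ'
  obtain ⟨k, hk⟩ :=
    exists_copStep_of_not_robberWinsAt (fun k => (hm k).2) hσ' hvw hw hwx hx
  exact h k _ (hm k) hk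

/-- Coinduction up to positions already known to be lost for Robber. If Robber stays, so do the
cops, hence only his moves along edges need an answer. -/
theorem not_robberWinsAt_of_invariant (Safe : 𝒢.V → (ι → 𝒢.V) → Prop)
    (hRobber : ∀ u σ, Safe u σ → u ∉ 𝒢.copRegion)
    (hCops : ∀ u σ, Safe u σ → ∀ k, σ k ∈ 𝒢.copRegion)
    (hAdj : ∀ u σ v, Safe u σ → 𝒢.graph.Adj u v → (∀ k, σ k ≠ v) → v ∉ 𝒢.copRegion ∧
      ∃ σ' : ι → 𝒢.V, (∀ k, 𝒢.CopStep (σ k) (σ' k)) ∧ (Safe v σ' ∨ ¬ RobberWinsAt e v σ'))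
    (h : Safe u σ) : ¬ RobberWinsAt e u σ := by
  intro hW
  unfold RobberWinsAt at hW
  generalize hs : σ ∘ e = s at hW
  have hfree {σ : ι → 𝒢.V} {v : 𝒢.V} (h : ∀ i, (σ ∘ e) i ≠ v) : ∀ k, σ k ≠ v :=
    e.forall_congr_right.1 h
  induction hW generalizing σ with subst hs
  | enter u v _ hm hv =>
    rcases hm.1 with rfl | huv
    · exact hRobber _ _ h hv
    · exact (hAdj u σ v h huv (hfree hm.2)).1 hv
  | step u v _ hm _ hW ih =>
    rcases hm.1 with rfl | huv
    · exact ih _ (copMove_comp_iff.2 fun k => ⟨.inl rfl, hCops _ _ h k⟩) h rfl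
    · obtain ⟨-, σ', hσ', hS | hL⟩ := hAdj u σ v h huv (hfree hm.2)
      · exact ih _ (copMove_comp_iff.2 hσ') hS rfl
      · exact hL (hW _ (copMove_comp_iff.2 hσ'))

theorem not_robberWinsAt_of_forall_adj (hu : u ∉ 𝒢.copRegion) (hσ : ∀ k, σ k ∈ 𝒢.copRegion)
    (h : ∀ v, 𝒢.graph.Adj u v → (∀ k, σ k ≠ v) → v ∉ 𝒢.copRegion ∧
      ∃ σ' : ι → 𝒢.V, (∀ k, 𝒢.CopStep (σ k) (σ' k)) ∧ ¬ RobberWinsAt e v σ') :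
    ¬ RobberWinsAt e u σ := by
  refine not_robberWinsAt_of_invariant (fun u' σ' => u' = u ∧ σ' = σ) ?_ ?_ ?_ ⟨rfl, rfl⟩
  · rintro _ _ ⟨rfl, rfl⟩
    exact hu
  · rintro _ _ ⟨rfl, rfl⟩
    exact hσ
  · rintro _ _ v ⟨rfl, rfl⟩ huv hfree
    obtain ⟨hv, σ', hm, hL⟩ := h v huv hfree
    exact ⟨hv, σ', hm, .inr hL⟩

theorem not_robberWinsAt_of_guarded_exit (hu : u ∉ 𝒢.copRegion)
    (hσ : ∀ k, σ k ∈ 𝒢.copRegion) (hexit : ∀ w, 𝒢.graph.Adj u w → w = v) (hv : ∃ k, σ k = v) :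
    ¬ RobberWinsAt e u σ := by
  refine not_robberWinsAt_of_forall_adj hu hσ fun w hw hfree => ?_
  obtain ⟨k, hk⟩ := hv
  exact (hfree k (hk.trans (hexit w hw).symm)).elim

theorem exists_copStep_forall_and_apply_eq {κ : Sort*} {k : κ → ι} (hk : Function.Injective k)
    {t : κ → 𝒢.V} (hσ : ∀ j, σ j ∈ 𝒢.copRegion) (h : ∀ i, 𝒢.CopStep (σ (k i)) (t i)) :
    ∃ σ' : ι → 𝒢.V, (∀ j, 𝒢.CopStep (σ j) (σ' j)) ∧ ∀ i, σ' (k i) = t i := by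
  refine ⟨Function.extend k t σ, fun j => ?_, hk.extend_apply t σ⟩
  by_cases hj : ∃ i, k i = j
  · obtain ⟨i, rfl⟩ := hj
    rw [hk.extend_apply]
    exact h i
  · rw [Function.extend_apply' _ _ _ hj]
    exact ⟨.inl rfl, hσ j⟩

end GuardingGame

namespace FormulaGame

/-! ### Moves of the formula-satisfying game -/

section Moves

/-- The function obtained from `f` by negating its value at `a`: the effect of one move of the
formula-satisfying game. -/
def toggle {α : Type*} [DecidableEq α] (f : α → Bool) (a : α) : α → Bool :=
  Function.update f a (!f a)

section Toggle

variable {α : Type*} [DecidableEq α] {f g : α → Bool} {a b : α}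

@[simp]
theorem toggle_self : toggle f a a = !f a := Function.update_self ..

theorem toggle_of_ne (h : b ≠ a) : toggle f a b = f b := Function.update_of_ne h ..

theorem eq_or_eq_toggle (h : ∀ b ≠ a, g b = f b) : g = f ∨ g = toggle f a := by
  by_cases ha : g a = f a
  · exact .inl (funext fun b => by grind)
  · exact .inr (Function.eq_update_iff.2 ⟨Bool.eq_not.2 ha, h⟩)

theorem forall_notMem_range_and_subsingleton_iff {κ : Type*} {i : κ → α}
    (hi : Function.Injective i) :
    (∀ a ∉ Set.range i, g a = f a) ∧ {k | g (i k) ≠ f (i k)}.Subsingleton ↔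
      g = f ∨ ∃ k, g = toggle f (i k) := by
  constructor
  · rintro ⟨hrange, hsub⟩
    by_cases h : ∃ k, g (i k) ≠ f (i k)
    · obtain ⟨k, hk⟩ := h
      refine (eq_or_eq_toggle (a := i k) fun a ha => ?_).imp_right fun h => ⟨k, h⟩
      by_contra hne
      obtain ⟨m, rfl⟩ := not_imp_comm.1 (hrange a) hne
      exact ha (congrArg i (hsub hne hk))
    · push Not at h
      exact .inl (funext fun a => by_contra fun hne =>
        let ⟨k, hk⟩ := not_imp_comm.1 (hrange a) hne
        hne (hk ▸ h k))
  · rintro (rfl | ⟨k, rfl⟩)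
    · exact ⟨fun _ _ => rfl, fun _ h => (h rfl).elim⟩
    · have eq_k {m : κ} (hm : toggle f (i k) (i m) ≠ f (i m)) : m = k :=
        hi (not_imp_comm.1 toggle_of_ne hm)
      exact ⟨fun a ha => toggle_of_ne fun h => ha ⟨k, h.symm⟩,
        fun m hm n hn => (eq_k hm).trans (eq_k hn).symm⟩

end Toggle

variable {ℱ : FormulaGame} {β β' : ℱ.Var → Bool}

theorem move_I_iff : ℱ.Move (.I, β) (.II, β') ↔
    ¬ ℱ.Holds ℱ.FC β ∧ (β' = β ∨ ∃ y, β' = toggle β (.inr y)) := by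
  rw [← forall_notMem_range_and_subsingleton_iff Sum.inr_injective]
  constructor
  · rintro (⟨_, _, hFC, hC, hR⟩ | _)
    exact ⟨hFC, by simpa using hC, hR⟩
  · rintro ⟨hFC, hC, hR⟩
    exact .one _ _ hFC (fun x => hC _ (by simp)) hR

theorem move_II_iff : ℱ.Move (.II, β) (.I, β') ↔
    ¬ ℱ.Holds ℱ.FR β ∧ (β' = β ∨ ∃ x, β' = toggle β (.inl x)) := by
  rw [← forall_notMem_range_and_subsingleton_iff Sum.inl_injective]
  constructor
  · rintro (_ | ⟨_, _, hFR, hR, hC⟩)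
    exact ⟨hFR, by simpa using hR, hC⟩
  · rintro ⟨hFR, hR, hC⟩
    exact .two _ _ hFR (fun y => hR _ (by simp)) hC

end Moves

/-! ### Formations of the cops -/

section Formations

variable {ℱ : FormulaGame}

variable (ℱ) in
/-- The roles of the cops: one cop for every variable, one for every clause of `F_C`, and
Commander. -/
inductive Role
  | var (x : ℱ.Var)
  | clause (ψ : Fin ℱ.FC.length)
  | commander

variable (ℱ) in
/-- The numbering of the cops that is used in `copStart`. -/
def role : Fin (ℱ.nC + ℱ.nR + ℱ.FC.length + 1) ≃ ℱ.Role :=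
  finSumFinEquiv.symm.trans <|
    ((finSumFinEquiv.symm.trans (finSumFinEquiv.symm.sumCongr (.refl _))).sumCongr
      (.refl _)).trans
    { toFun := Sum.elim (Sum.elim .var .clause) fun _ => .commander
      invFun
        | .var x => .inl (.inl x)
        | .clause ψ => .inl (.inr ψ)
        | .commander => .inr 0
      left_inv := by rintro ((_ | _) | i) <;> simp [Fin.fin_one_eq_zero]
      right_inv := by rintro (_ | _ | _) <;> rfl }

variable (ℱ) in
/-- A placement of the cops, indexed by their roles. -/
abbrev Formation : Type := ℱ.Role → ℱ.Vertex

/-- The vertex between `value x b` and `value x (!b)` in the Variable Cell of `x`. -/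
def Vertex.half (x : ℱ.Var) (b : Bool) : ℱ.Vertex := if b then .FT x else .TF x

/-- The vertex between `G x` and `value x b` in the Commander gadget. -/
def Vertex.guard (x : ℱ.Var) (b : Bool) : ℱ.Vertex := if b then .GT x else .GF x

/-- The formation in which the variable cops represent `β`, the clause cops stand at `c` and
Commander is at home. -/
def representing (β : ℱ.Var → Bool) (c : Fin ℱ.FC.length → ℱ.Vertex) : ℱ.Formation
  | .var x => .value x (β x)
  | .clause ψ => c ψ
  | .commander => .HQ

/-- The formation in which the cop of `x` is changing the value `β x`, while Commander replaces
him as a guard of `T x` and `F x`. -/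
def flipping (β : ℱ.Var → Bool) (x : ℱ.Var) (c : Fin ℱ.FC.length → ℱ.Vertex) : ℱ.Formation
  | .var z => if z = x then .half x (β x) else .value z (β z)
  | .clause ψ => c ψ
  | .commander => .G x

theorem copStart_eq : ℱ.copStart = representing ℱ.α .a ∘ ℱ.role := by
  refine funext (Fin.addCases (Fin.addCases (Fin.addCases ?_ ?_) ?_) ?_) <;>
    simp [copStart, role, representing]

/-- The robber-player wins with Robber on `u` and to move, and the cops at `σ`. -/
abbrev Wins (u : ℱ.Vertex) (σ : ℱ.Formation) : Prop :=
  GuardingGame.RobberWinsAt (𝒢 := ℱ.toGuardingGame) ℱ.role u σ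

/-- A legal step of a single cop. -/
abbrev Step (u v : ℱ.Vertex) : Prop := ℱ.toGuardingGame.CopStep u v

/-- A legal turn of the cops. -/
abbrev Moves (σ σ' : ℱ.Formation) : Prop := ∀ k, Step (σ k) (σ' k)

theorem robberWins_iff :
    ℱ.toGuardingGame.RobberWins ↔ Wins .start (representing ℱ.α (.a (ℱ := ℱ))) :=
  Iff.of_eq (congrArg (ℱ.toGuardingGame.RobberWinsFrom .start) copStart_eq)

theorem copStart_injective : Function.Injective ℱ.copStart := by
  have : Function.Injective (representing ℱ.α (.a (ℱ := ℱ))) := by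
    rintro (x | ψ | _) (y | χ | _) h <;> grind [representing, Vertex.value]
  exact copStart_eq (ℱ := ℱ) ▸ this.comp ℱ.role.injective

end Formations

/-! ### The confinement of the cops -/

section Confinement

variable {ℱ : FormulaGame} {s : ℱ.Station} {b : ℱ.Blocker} {k : ℱ.Role} {x : ℱ.Var}
  {c : Bool} {ψ : Fin ℱ.FC.length} {u v : ℱ.Vertex} {σ σ' : ℱ.Formation}

/-- The part of the cop-region to which the cop with a given role is confined in the robber-player's
analysis; Commander may replace a variable cop, but nobody else reaches the blockers that control
Commander. -/
def Zone : ℱ.Role → ℱ.Vertex → Prop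
  | .var x, .T z | .var x, .FT z | .var x, .F z | .var x, .TF z => z = x
  | .clause _, .a _ | .clause _, .a' _ | .clause _, .a'' | .clause _, .a''' _ => True
  | .commander, .HQ | .commander, .G _ | .commander, .GT _ | .commander, .GF _
  | .commander, .T _ | .commander, .FT _ | .commander, .F _ | .commander, .TF _
  | .commander, .q _ => True
  | .var _, .q (.command _) | .clause _, .q (.command _) => False
  | .var _, .q _ | .clause _, .q _ => True
  | _, _ => False

theorem eq_HQ_or_eq_G_of_mem_blocked_command (h : u ∈ (Blocker.command s).blocked) :
    u = .HQ ∨ ∃ x, u = .G x := by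
  cases s <;> grind [Blocker.blocked]

theorem Zone.eq_commander (h : Zone k u)
    (hu : u = .q (.command s) ∨ u ∈ (Blocker.command s).blocked) : k = .commander := by
  have hu : u = .q (.command s) ∨ u = .HQ ∨ ∃ x, u = .G x :=
    hu.imp_right eq_HQ_or_eq_G_of_mem_blocked_command
  cases k with
  | commander => rfl
  | _ => obtain rfl | rfl | ⟨x, rfl⟩ := hu <;> exact h.elim

theorem Zone.q (h : Zone k u) (hu : u ∈ b.blocked) : Zone k (.q b) := by
  cases k with
  | commander => trivial
  | _ =>
    cases b with
    | command s => nomatch h.eq_commander (.inr hu)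
    | _ => trivial

theorem Zone.step (h : Zone k u) (hstep : Step u v) : Zone k v := by
  obtain ⟨rfl | hE, -⟩ := hstep
  · exact h
  · cases hE with
    | blocked_q b _ hb => exact h.q hb
    | _ => cases k <;> first | exact h | trivial

theorem Zone.inCopRegion (h : Zone k u) : u.InCopRegion := by
  cases u <;> cases k <;> trivial

theorem Step.eq_of_q (h : Step (.q b) v) : v = .q b := by
  obtain ⟨rfl | hE, -⟩ := h
  · rfl
  · cases hE with
    | blocked_q c _ hc =>
      cases c with
      | command s => cases s <;> grind [Blocker.blocked]
      | _ => grind [Blocker.blocked, Vertex.value]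

/-- The station that follows on the Basic Cycle. -/
def Station.next : ℱ.Station → ℱ.Station
  | .RM => .RT
  | .RT => .CM
  | .CM => .RW
  | .RW => .CT
  | .CT => .RM
  | .Sw _ => .RT

theorem Edge.station_next (s : ℱ.Station) : ℱ.Edge (.station s) (.station s.next) := by
  cases s <;> constructor

theorem Station.next_ne (s : ℱ.Station) : s.next ≠ s := by cases s <;> nofun

/-- Every cop is in his zone. -/
def Roams (σ : ℱ.Formation) : Prop := ∀ k, Zone k (σ k)

namespace Roams

theorem of_moves (hσ : Roams σ) (hm : Moves σ σ') : Roams σ' := fun k => (hσ k).step (hm k)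

theorem exists_moves_of_not_wins (hσ : Roams σ) (h : ¬ Wins u σ) (huv : ℱ.Edge u v)
    (hv : ¬ v.InCopRegion) : ∃ σ', Moves σ σ' ∧ Roams σ' ∧ ¬ Wins v σ' := by
  contrapose! h
  exact .of_step huv hv (fun k => (hσ k).inCopRegion) fun σ' hm => h σ' hm (hσ.of_moves hm)

theorem exists_guard_of_not_wins (hσ : Roams σ) (h : ¬ Wins (.station b.source) σ) :
    ∃ k, σ k = .q b ∨ σ k ∈ b.blocked ∨ σ k = .a'' ∧ ∃ φ, b = .robberGate φ := by
  obtain ⟨k, hk | hE, -⟩ := GuardingGame.exists_copStep_of_not_robberWinsAt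
    (fun k => (hσ k).inCopRegion) h (.source_p b) id (.p_q b) trivial
  · exact ⟨k, .inl hk.symm⟩
  · refine ⟨k, .inr ?_⟩
    have hk := (hσ k).inCopRegion
    generalize σ k = u at hE hk
    cases hE with
    | p_q => exact hk.elim
    | blocked_q _ _ hb => exact .inl hb
    | a''_z φ => exact .inr ⟨rfl, φ, rfl⟩

theorem commander_eq_q_or_mem_blocked (hσ : Roams σ) (h : ¬ Wins (.station s) σ) :
    σ .commander = .q (.command s) ∨ σ .commander ∈ (Blocker.command s).blocked := by
  obtain ⟨k, hk⟩ := hσ.exists_guard_of_not_wins (b := .command s) h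
  have hk : σ k = .q (.command s) ∨ σ k ∈ (Blocker.command s).blocked := by simpa using hk
  obtain rfl := (hσ k).eq_commander hk
  exact hk

theorem commander_mem_blocked (hσ : Roams σ) (h : ¬ Wins (.station s) σ) :
    σ .commander ∈ (Blocker.command s).blocked := by
  refine (hσ.commander_eq_q_or_mem_blocked h).resolve_left fun hq => ?_
  obtain ⟨σ', hm, hσ', h'⟩ := hσ.exists_moves_of_not_wins h (.station_next s) id
  have hq' : σ' .commander = .q (.command s) := (hq ▸ hm .commander : Step _ _).eq_of_q
  obtain hnext | hblk := hσ'.commander_eq_q_or_mem_blocked h'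
  · exact s.next_ne (by grind)
  · grind [eq_HQ_or_eq_G_of_mem_blocked_command hblk]

end Roams

theorem Edge.source_of_half (h : ℱ.Edge u (.half x c)) : u = .value x c := by
  cases c <;> cases h <;> rfl

theorem Edge.source_of_guard (h : ℱ.Edge u (.guard x c)) : u = .G x := by
  cases c <;> cases h <;> rfl

theorem Edge.source_of_value (h : ℱ.Edge u (.value x c)) (hu : u.InCopRegion) :
    u = .half x (!c) ∨ u = .guard x c := by
  cases c <;> cases h <;> first | exact hu.elim | exact .inl rfl | exact .inr rfl

theorem Step.source_of_value (h₁ : Step u v) (h₂ : Step v (.value x c)) (hu : u.InCopRegion) :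
    u = .value x c ∨ u = .value x (!c) ∨ u = .half x (!c) ∨ u = .guard x c ∨ u = .G x := by
  obtain ⟨rfl | h₁, hv⟩ := h₁ <;> obtain ⟨rfl | h₂, -⟩ := h₂
  · exact .inl rfl
  · exact .inr (.inr ((h₂.source_of_value hu).imp_right .inl))
  · exact .inr (.inr ((h₁.source_of_value hu).imp_right .inl))
  · obtain rfl | rfl := h₂.source_of_value hv
    · exact .inr (.inl h₁.source_of_half)
    · exact .inr (.inr (.inr (.inr h₁.source_of_guard)))

theorem Step.source_of_a (h₁ : Step u v) (h₂ : Step v (.a ψ)) (hu : u.InCopRegion) :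
    u = .a ψ ∨ u = .a''' ψ ∨ u = .a'' := by
  obtain ⟨rfl | h₁, hv⟩ := h₁ <;> obtain ⟨rfl | h₂, -⟩ := h₂
  · exact .inl rfl
  · cases h₂ with
    | barA_a => exact hu.elim
    | a'''_a => exact .inr (.inl rfl)
  · cases h₁ with
    | barA_a => exact hu.elim
    | a'''_a => exact .inr (.inl rfl)
  · cases h₂ with
    | barA_a => exact hv.elim
    | a'''_a => cases h₁; exact .inr (.inr rfl)

namespace Roams

theorem exists_two_steps_value (hσ : Roams σ) (h : ¬ Wins (.station s) σ) (x : ℱ.Var) (c : Bool) :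
    ∃ k v, Step (σ k) v ∧ Step v (.value x c) := by
  have hin : ∀ k, (σ k).InCopRegion := fun k => (hσ k).inCopRegion
  cases c
  · exact GuardingGame.exists_copStep_copStep_of_not_robberWinsAt hin h (.station_forceF s) id
      (.forceF_barF x) id (.barF_F x) trivial
  · exact GuardingGame.exists_copStep_copStep_of_not_robberWinsAt hin h (.station_forceT s) id
      (.forceT_barT x) id (.barT_T x) trivial

theorem near_value (hσ : Roams σ) (h : ¬ Wins (.station s) σ) (hx : σ .commander ≠ .G x)
    (c : Bool) :
    σ (.var x) = .value x c ∨ σ (.var x) = .value x (!c) ∨ σ (.var x) = .half x (!c) := by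
  obtain ⟨k, v, h₁, h₂⟩ := hσ.exists_two_steps_value h x c
  have hk := h₁.source_of_value h₂ (hσ k).inCopRegion
  have hZ := hσ k
  have hc := eq_HQ_or_eq_G_of_mem_blocked_command (hσ.commander_mem_blocked h)
  cases c <;> cases k <;> grind [Zone, Vertex.value, Vertex.half, Vertex.guard]

theorem exists_eq_value (hσ : Roams σ) (h : ¬ Wins (.station s) σ) (hx : σ .commander ≠ .G x) :
    ∃ c, σ (.var x) = .value x c := by
  have hT := hσ.near_value h hx true
  have hF := hσ.near_value h hx false
  grind [Vertex.value, Vertex.half]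

end Roams

/-- The positions of the cop of the clause `ψ` that are harmless for Robber. Once on `a''`, a cop
would guard the vertices `a` of all clauses. -/
def NearGate (ψ : Fin ℱ.FC.length) (u : ℱ.Vertex) : Prop :=
  u = .a ψ ∨ u = .a' ψ ∨ ∃ i, u = .q (.copGate ψ i)

theorem NearGate.step (hu : NearGate ψ u) (hu' : u ≠ .a' ψ) (h : Step u v) : NearGate ψ v := by
  obtain rfl | rfl | ⟨i, rfl⟩ := hu
  · obtain ⟨rfl | hE, -⟩ := h
    · exact .inl rfl
    · cases hE with
      | blocked_q b _ hb =>
        cases b with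
        | copGate χ i =>
          obtain rfl : χ = ψ := by grind [Blocker.blocked, Vertex.value]
          exact .inr (.inr ⟨i, rfl⟩)
        | command s => nomatch eq_HQ_or_eq_G_of_mem_blocked_command hb
        | _ => grind [Blocker.blocked, Vertex.value]
      | a_a' => exact .inr (.inl rfl)
  · exact (hu' rfl).elim
  · exact .inr (.inr ⟨i, Step.eq_of_q h⟩)

theorem Step.nearGate (h : Step (.a ψ) u) : NearGate ψ u :=
  NearGate.step (.inl rfl) (by simp) h

theorem Step.of_value (h : Step (.value x c) v) :
    v = .value x c ∨ v = .half x c ∨ ∃ b, v = .q b ∧ .value x c ∈ b.blocked := by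
  obtain ⟨rfl | hE, -⟩ := h
  · exact .inl rfl
  · cases c <;> cases hE <;> grind [Vertex.half]

theorem Step.value_eq {d : Bool} (h : Step (.value x c) (.value x d)) : d = c := by
  have := h.of_value
  grind [Vertex.value, Vertex.half]

theorem Step.eq_not {d : Bool} (h : Step (.half x c) (.value x d)) : d = !c := by
  obtain ⟨h | hE, -⟩ := h
  · cases c <;> cases d <;> nomatch h
  · cases c <;> cases d <;> cases hE <;> rfl

end Confinement

/-! ### The strategy of Robber -/

section RobberStrategy

variable {ℱ : FormulaGame} {s : ℱ.Station} {x : ℱ.Var} {σ σ' : ℱ.Formation}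
  {β β' : ℱ.Var → Bool} {c : Fin ℱ.FC.length → ℱ.Vertex}


theorem eq_of_moves_representing {c' : Fin ℱ.FC.length → ℱ.Vertex}
    (h : Moves (representing β c) (representing β' c')) : β' = β :=
  funext fun x => Step.value_eq (h (.var x))

theorem eq_toggle_of_moves_flipping {c' : Fin ℱ.FC.length → ℱ.Vertex}
    (h : Moves (flipping β x c) (representing β' c')) : β' = toggle β x := by
  refine Function.eq_update_iff.2 ⟨?_, fun z hz => ?_⟩
  · have hx := h (.var x)
    simp only [flipping, if_true] at hx
    exact Step.eq_not hx
  · have hz' := h (.var z)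
    simp only [flipping, if_neg hz] at hz'
    exact Step.value_eq hz'

theorem roams_representing (β : ℱ.Var → Bool) : Roams (representing β .a) := by
  rintro (x | _ | _)
  · cases h : β x <;> simp [representing, Vertex.value, h, Zone]
  all_goals trivial

namespace Roams

theorem clause_eq (hσ : Roams σ) (h : ¬ Wins (.station s) σ) (hs : s ≠ .CT)
    (hnear : ∀ χ, NearGate χ (σ (.clause χ))) (ψ : Fin ℱ.FC.length) :
    σ (.clause ψ) = .a ψ := by
  obtain ⟨k, v, h₁, h₂⟩ := GuardingGame.exists_copStep_copStep_of_not_robberWinsAt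
    (fun k => (hσ k).inCopRegion) h (.station_forceA s hs) id (.forceA_barA ψ) id (.barA_a ψ)
    trivial
  have hk := Step.source_of_a h₁ h₂ (hσ k).inCopRegion
  have hZ := hσ k
  cases k <;> grind [Zone, NearGate]

theorem exists_eq_representing (hσ : Roams σ) (h : ¬ Wins (.station s) σ)
    (hs : (Blocker.command s).blocked = {.HQ}) :
    ∃ β, σ = representing β fun ψ => σ (.clause ψ) := by
  have hc : σ .commander = .HQ := by simpa [hs] using hσ.commander_mem_blocked h
  choose β hβ using fun x => hσ.exists_eq_value (x := x) h (by simp [hc])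
  refine ⟨β, funext ?_⟩
  rintro (x | _ | _)
  exacts [hβ x, rfl, hc]

theorem exists_eq_representing_a (hσ : Roams σ) (h : ¬ Wins (.station s) σ) (hCT : s ≠ .CT)
    (hs : (Blocker.command s).blocked = {.HQ}) (hnear : ∀ χ, NearGate χ (σ (.clause χ))) :
    ∃ β, σ = representing β .a := by
  obtain ⟨β, hβ⟩ := hσ.exists_eq_representing h hs
  exact ⟨β, by rwa [funext (hσ.clause_eq h hCT hnear)] at hβ⟩

theorem var_eq (hσ : Roams σ) (h : ¬ Wins (.station s) σ) (hx : σ .commander ≠ .G x)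
    (hm : Moves (representing β c) σ) : σ (.var x) = .value x (β x) := by
  obtain ⟨d, hd⟩ := hσ.exists_eq_value h hx
  have hstep := hm (.var x)
  rw [hd] at hstep ⊢
  rw [Step.value_eq hstep]

end Roams

theorem not_holds_FR_of_not_wins (h : ¬ Wins (.station .RT) (representing β .a)) :
    ¬ ℱ.Holds ℱ.FR β := by
  rintro ⟨φ, hφ, hβ⟩
  obtain ⟨i, rfl⟩ := List.get_of_mem hφ
  obtain ⟨x | ψ | _, hq | ⟨l, hl, hv⟩ | ⟨ha, -⟩⟩ :=
    (roams_representing β).exists_guard_of_not_wins (b := .robberGate i) h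
  · grind [representing, Vertex.value]
  · have := hβ l hl
    grind [representing, Vertex.value]
  all_goals grind [representing, Vertex.value]

theorem ne_a'_of_not_wins (hσ : Roams (representing β c))
    (h : ¬ Wins (.station .CT) (representing β c)) (hc : ∀ ψ, NearGate ψ (c ψ))
    (hFC : ¬ ℱ.Holds ℱ.FC β) (ψ : Fin ℱ.FC.length) : c ψ ≠ .a' ψ := by
  intro ha'
  obtain ⟨l, hl, hlβ⟩ : ∃ l ∈ ℱ.FC.get ψ, β l.1 ≠ l.2 := by
    by_contra! hψ
    exact hFC ⟨_, List.get_mem .., hψ⟩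
  obtain ⟨i, rfl⟩ := List.get_of_mem hl
  obtain ⟨k, hk⟩ := hσ.exists_guard_of_not_wins (b := .copGate ψ i) h
  simp only [Blocker.blocked, Set.mem_insert_iff, Set.mem_singleton_iff] at hk
  match k with
  | .var x => grind [representing, Vertex.value]
  | .clause χ =>
    have := hc χ
    grind [representing, Vertex.value, NearGate]
  | .commander => grind [representing, Vertex.value]

theorem Roams.eq_flipping (hσ : Roams σ) {y : Fin ℱ.nR} (h : ¬ Wins (.station (.Sw y)) σ)
    (hm : Moves (representing β .a) σ) : σ = flipping β (.inr y) .a := by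
  have hc : σ .commander = .G (.inr y) := hσ.commander_mem_blocked h
  have hclause := hσ.clause_eq h nofun fun χ => Step.nearGate (hm (.clause χ))
  have hy : σ (.var (.inr y)) = .half (.inr y) (β (.inr y)) := by
    obtain ⟨k, hk⟩ := hσ.exists_guard_of_not_wins (b := .robberSwitch y) h
    simp only [Blocker.blocked, Set.mem_insert_iff, Set.mem_singleton_iff] at hk
    match k with
    | .var x =>
      have hx := Step.of_value (hm (.var x))
      grind [Vertex.value, Vertex.half, Blocker.blocked]
    | .clause χ => simp [hclause χ] at hk
    | .commander => simp [hc] at hk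
  refine funext ?_
  rintro (x | ψ | _)
  · by_cases hx : x = .inr y
    · subst hx
      simpa [flipping] using hy
    · simpa [flipping, hx] using hσ.var_eq h (by simp [hc, Ne.symm hx]) hm
  exacts [hclause ψ, hc]

theorem exists_eq_representing_of_not_wins_RW (hσ : Roams σ) (hm : Moves (representing β .a) σ)
    (h : ¬ Wins (.station .CM) σ) (hσ' : Roams σ') (hm' : Moves σ σ')
    (h' : ¬ Wins (.station .RW) σ') :
    ∃ β', σ' = representing β' .a ∧ (β' = β ∨ ∃ x, β' = toggle β (.inl x)) := by
  have hclause := hσ.clause_eq h nofun fun χ => Step.nearGate (hm (.clause χ))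
  obtain ⟨β', rfl⟩ := hσ'.exists_eq_representing_a h' nofun rfl fun χ =>
    Step.nearGate (hclause χ ▸ hm' (.clause χ))
  have agree {z : ℱ.Var} (hz : σ .commander ≠ .G z) : β' z = β z :=
    Step.value_eq (hσ.var_eq h hz hm ▸ hm' (.var z))
  refine ⟨β', rfl, ?_⟩
  obtain hc | ⟨x, hc⟩ : σ .commander = .HQ ∨ ∃ x, σ .commander = .G (.inl x) :=
    hσ.commander_mem_blocked h
  · exact .inl (funext fun z => agree (by simp [hc]))
  · refine (eq_or_eq_toggle fun z hz => agree ?_).imp_right fun h => ⟨x, h⟩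
    simpa [hc] using hz.symm

/-- The station at which Robber is when the formula of the opponent of `τ` is tested. -/
def testStation : Player → ℱ.Station
  | .I => .CT
  | .II => .RT

/-- `τ` is to move in the formula-satisfying game at the assignment that the cops represent, and
Robber wins when he goes to the corresponding test. -/
def TestWins : Player × (ℱ.Var → Bool) → Prop
  | (τ, β) => ∀ σ, Moves (representing β .a) σ → Wins (.station (testStation τ)) σ

theorem testWins_II (h : ∀ β', ℱ.Move (.II, β) (.I, β') → TestWins (.I, β')) :
    TestWins (.II, β) := by
  intro σ hm
  by_contra hL
  have hσ := (roams_representing β).of_moves hm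
  obtain ⟨β', rfl⟩ := hσ.exists_eq_representing_a hL nofun rfl fun χ =>
    Step.nearGate (hm (.clause χ))
  obtain rfl := eq_of_moves_representing hm
  obtain ⟨σ₁, hm₁, hσ₁, h₁⟩ := hσ.exists_moves_of_not_wins hL .RT_CM id
  obtain ⟨σ₂, hm₂, hσ₂, h₂⟩ := hσ₁.exists_moves_of_not_wins h₁ .CM_RW id
  obtain ⟨β₂, rfl, hβ₂⟩ := exists_eq_representing_of_not_wins_RW hσ₁ hm₁ h₁ hσ₂ hm₂ h₂
  obtain ⟨σ₃, hm₃, -, h₃⟩ := hσ₂.exists_moves_of_not_wins h₂ .RW_CT id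
  exact h₃ (h β₂ (move_II_iff.2 ⟨not_holds_FR_of_not_wins hL, hβ₂⟩) σ₃ hm₃)

theorem wins_RM_of_testWins
    (h : TestWins (.II, β) ∨ ∃ y, TestWins (.II, toggle β (.inr y))) :
    Wins (.station .RM) (representing β .a) := by
  by_contra hL
  have hσ := roams_representing β
  obtain h | ⟨y, h⟩ := h
  · obtain ⟨σ, hm, -, h'⟩ := hσ.exists_moves_of_not_wins hL .RM_RT id
    exact h' (h σ hm)
  · obtain ⟨σ₁, hm₁, hσ₁, h₁⟩ := hσ.exists_moves_of_not_wins hL (.RM_Sw y) id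
    obtain rfl := hσ₁.eq_flipping h₁ hm₁
    obtain ⟨σ₂, hm₂, hσ₂, h₂⟩ := hσ₁.exists_moves_of_not_wins h₁ (.Sw_RT y) id
    obtain ⟨β₂, rfl⟩ := hσ₂.exists_eq_representing_a h₂ nofun rfl fun χ =>
      Step.nearGate (hm₂ (.clause χ))
    obtain rfl := eq_toggle_of_moves_flipping hm₂
    exact h₂ (h _ fun k => ⟨.inl rfl, (hσ₂ k).inCopRegion⟩)

theorem testWins_I (hFC : ¬ ℱ.Holds ℱ.FC β) (h : Wins (.station .RM) (representing β .a)) :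
    TestWins (.I, β) := by
  intro σ hm
  by_contra hL
  have hσ := (roams_representing β).of_moves hm
  obtain ⟨β', hβ'⟩ := hσ.exists_eq_representing hL rfl
  generalize (fun ψ => σ (.clause ψ)) = c at hβ'
  obtain rfl := hβ'
  obtain rfl := eq_of_moves_representing hm
  have hc ψ : NearGate ψ (c ψ) := Step.nearGate (hm (.clause ψ))
  have hc' := ne_a'_of_not_wins hσ hL hc hFC
  obtain ⟨σ₁, hm₁, hσ₁, h₁⟩ := hσ.exists_moves_of_not_wins hL .CT_RM id
  obtain ⟨β₁, rfl⟩ := hσ₁.exists_eq_representing_a h₁ nofun rfl fun ψ =>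
    (hc ψ).step (hc' ψ) (hm₁ (.clause ψ))
  obtain rfl := eq_of_moves_representing hm₁
  exact h₁ h

theorem testWins_of_winsI {p : Player × (ℱ.Var → Bool)} (h : ℱ.WinsI p) : TestWins p := by
  induction h with
  | one β q hm _ ih =>
    obtain ⟨_ | _, β'⟩ := q
    · nomatch hm
    obtain ⟨hFC, rfl | ⟨y, rfl⟩⟩ := move_I_iff.1 hm
    · exact testWins_I hFC (wins_RM_of_testWins (.inl ih))
    · exact testWins_I hFC (wins_RM_of_testWins (.inr ⟨y, ih⟩))
  | two β _ ih => exact testWins_II fun β' => ih (.I, β')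

variable (ℱ) in
theorem edge_start_testStation : ℱ.Edge .start (.station (testStation ℱ.τ)) := by
  cases h : ℱ.τ
  exacts [.start_CT h, .start_RT h]

theorem robberWins_of_playerIWins (h : ℱ.PlayerIWins) : ℱ.toGuardingGame.RobberWins :=
  robberWins_iff.2 <| .of_step ℱ.edge_start_testStation id
    (fun k => (roams_representing _ k).inCopRegion) (testWins_of_winsI h)

end RobberStrategy

/-! ### The strategy of the cops -/

section CopStrategy

variable {ℱ : FormulaGame} {s t : ℱ.Station} {b : ℱ.Blocker} {k : ℱ.Role} {x : ℱ.Var}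
  {ψ : Fin ℱ.FC.length} {u v w : ℱ.Vertex} {σ : ℱ.Formation}

theorem Blocker.inCopRegion_of_mem_blocked (h : u ∈ b.blocked) : u.InCopRegion := by
  cases u with
  | start | station | p | forceT | forceF | forceA | forceA'' | barT | barF | barA | barA'' =>
    cases b with
    | command s => nomatch eq_HQ_or_eq_G_of_mem_blocked_command h
    | _ => grind [Blocker.blocked, Vertex.value]
  | _ => trivial

theorem Edge.eq_of_border (h : ℱ.Edge u v) (hu : ¬ u.InCopRegion) (hv : v.InCopRegion)
    (hw : ℱ.Edge u w) : w = v := by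
  cases h with
  | p_q | barT_T | barF_F | barA_a | barA''_a'' =>
    cases hw with
    | blocked_q _ _ h => exact (hu (Blocker.inCopRegion_of_mem_blocked h)).elim
    | _ => rfl
  | blocked_q _ _ h => exact (hu (Blocker.inCopRegion_of_mem_blocked h)).elim
  | _ => first | exact hv.elim | exact (hu trivial).elim

theorem Edge.value_half (x : ℱ.Var) (c : Bool) : ℱ.Edge (.value x c) (.half x c) := by
  cases c <;> constructor

theorem Edge.half_value (x : ℱ.Var) (c : Bool) : ℱ.Edge (.half x c) (.value x (!c)) := by
  cases c <;> constructor

theorem Edge.G_guard (x : ℱ.Var) (c : Bool) : ℱ.Edge (.G x) (.guard x c) := by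
  cases c <;> constructor

theorem Edge.guard_value (x : ℱ.Var) (c : Bool) : ℱ.Edge (.guard x c) (.value x c) := by
  cases c <;> constructor

theorem inCopRegion_value (x : ℱ.Var) (c : Bool) : (Vertex.value x c).InCopRegion := by
  cases c <;> trivial

theorem inCopRegion_half (x : ℱ.Var) (c : Bool) : (Vertex.half x c).InCopRegion := by
  cases c <;> trivial

theorem inCopRegion_guard (x : ℱ.Var) (c : Bool) : (Vertex.guard x c).InCopRegion := by
  cases c <;> trivial

theorem exists_step_step_value (x : ℱ.Var) (c d : Bool) :
    ∃ v, Step (.value x c) v ∧ Step v (.value x d) := by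
  rcases Bool.eq_or_eq_not d c with rfl | rfl
  · exact ⟨_, ⟨.inl rfl, inCopRegion_value ..⟩, .inl rfl, inCopRegion_value ..⟩
  · exact ⟨_, ⟨.inr (.value_half x c), inCopRegion_half ..⟩, .inr (.half_value x c),
      inCopRegion_value ..⟩

theorem not_wins_of_guarded_exit (hu : ¬ u.InCopRegion) (hv : v.InCopRegion) (huv : ℱ.Edge u v)
    (hσ : ∀ k, (σ k).InCopRegion) (h : σ k = v) : ¬ Wins u σ :=
  GuardingGame.not_robberWinsAt_of_guarded_exit hu hσ (fun _ hw => huv.eq_of_border hu hv hw)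
    ⟨k, h⟩

theorem exists_moves_not_wins_of_edge (hu : ¬ u.InCopRegion) (huv : ℱ.Edge u v)
    (hσ : ∀ k, (σ k).InCopRegion) (h : Step (σ k) v) : ∃ σ', Moves σ σ' ∧ ¬ Wins u σ' := by
  obtain ⟨σ', hm, hk⟩ := GuardingGame.exists_copStep_forall_and_apply_eq
    (Function.injective_of_subsingleton fun _ : Unit => k) hσ fun _ => h
  exact ⟨σ', hm, not_wins_of_guarded_exit hu h.2 huv (fun j => (hm j).2) (hk ())⟩

theorem exists_moves_not_wins_of_enforcer {κ : Sort*} {k : κ → ℱ.Role}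
    (hk : Function.Injective k) {target : κ → ℱ.Vertex} (hσ : ∀ j, (σ j).InCopRegion)
    (hstep : ∀ i, ∃ v, Step (σ (k i)) v ∧ Step v (target i)) (hu : ¬ u.InCopRegion)
    (hadj : ∀ v, ℱ.Edge u v → ¬ v.InCopRegion ∧ ∃ i, ℱ.Edge v (target i)) :
    ∃ σ', Moves σ σ' ∧ ¬ Wins u σ' := by
  choose t hst ht using hstep
  obtain ⟨σ', hm, hk'⟩ := GuardingGame.exists_copStep_forall_and_apply_eq hk hσ hst
  refine ⟨σ', hm, GuardingGame.not_robberWinsAt_of_forall_adj hu (fun j => (hm j).2)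
    fun v huv _ => ?_⟩
  obtain ⟨hv, i, hvi⟩ := hadj v huv
  exact ⟨hv, exists_moves_not_wins_of_edge hv hvi (fun j => (hm j).2) (hk' i ▸ ht i)⟩

/-- With Robber on the station `s`, the cops can answer every move of Robber that leaves the
stations. -/
structure OnGuard (s : ℱ.Station) (σ : ℱ.Formation) : Prop where
  inCopRegion : ∀ k, (σ k).InCopRegion
  blocker : ∀ b : ℱ.Blocker, b.source = s → ∃ k, ℱ.Edge (σ k) (.q b)
  value : ∀ x, (∃ c, σ (.var x) = .value x c) ∨ σ .commander = .G x
  clause : s ≠ .CT → ∀ ψ, σ (.clause ψ) = .a ψ ∨ σ (.clause ψ) = .a''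

namespace OnGuard

theorem exists_moves_not_wins_force_value (h : OnGuard s σ) (c : Bool) (hu : ¬ u.InCopRegion)
    (hadj : ∀ v, ℱ.Edge u v → ¬ v.InCopRegion ∧ ∃ x, ℱ.Edge v (.value x c)) :
    ∃ σ', Moves σ σ' ∧ ¬ Wins u σ' := by
  classical
  let k (x : ℱ.Var) : ℱ.Role := if σ .commander = .G x then .commander else .var x
  refine exists_moves_not_wins_of_enforcer (k := k) (fun x y hxy => by grind) h.inCopRegion
    (fun x => ?_) hu hadj
  by_cases hx : σ .commander = .G x
  · rw [show k x = .commander from if_pos hx, hx]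
    exact ⟨_, ⟨.inr (.G_guard x c), inCopRegion_guard ..⟩, .inr (.guard_value x c),
      inCopRegion_value ..⟩
  · obtain ⟨d, hd⟩ := (h.value x).resolve_right hx
    rw [show k x = .var x from if_neg hx, hd]
    exact exists_step_step_value x d c

theorem exists_moves_not_wins_forceA (h : OnGuard s σ) (hs : s ≠ .CT) :
    ∃ σ', Moves σ σ' ∧ ¬ Wins .forceA σ' := by
  refine exists_moves_not_wins_of_enforcer (k := .clause) (target := .a)
    (fun _ _ => Role.clause.inj) h.inCopRegion (fun ψ => ?_) id ?_
  · obtain hψ | hψ := h.clause hs ψ <;> rw [hψ]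
    · exact ⟨.a ψ, ⟨.inl rfl, trivial⟩, .inl rfl, trivial⟩
    · exact ⟨.a''' ψ, ⟨.inr (.a''_a''' ψ), trivial⟩, .inr (.a'''_a ψ), trivial⟩
  · intro v hv
    cases hv with
    | blocked_q _ _ hb => exact (Blocker.inCopRegion_of_mem_blocked hb).elim
    | forceA_barA ψ => exact ⟨id, ψ, .barA_a ψ⟩

theorem exists_moves_not_wins_forceA'' (h : OnGuard s σ) (hs : s ≠ .CT) :
    ∃ σ', Moves σ σ' ∧ ¬ Wins .forceA'' σ' := by
  refine exists_moves_not_wins_of_enforcer (κ := ℱ.FC ≠ [])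
    (k := fun hFC => .clause ⟨0, List.length_pos_iff.2 hFC⟩) (target := fun _ => .a'')
    (Function.injective_of_subsingleton _) h.inCopRegion (fun hFC => ?_) id ?_
  · obtain hψ | hψ := h.clause hs ⟨0, List.length_pos_iff.2 hFC⟩ <;> rw [hψ]
    · exact ⟨.a' _, ⟨.inr (.a_a' _), trivial⟩, .inr (.a'_a'' _), trivial⟩
    · exact ⟨.a'', ⟨.inl rfl, trivial⟩, .inl rfl, trivial⟩
  · intro v hv
    cases hv with
    | blocked_q _ _ hb => exact (Blocker.inCopRegion_of_mem_blocked hb).elim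
    | forceA''_barA'' hFC => exact ⟨id, hFC, .barA''_a''⟩

theorem exists_moves_not_wins (h : OnGuard s σ) (hE : ℱ.Edge (.station s) u)
    (hu : ∀ t, u ≠ .station t) : ∃ σ', Moves σ σ' ∧ ¬ Wins u σ' := by
  cases hE with
  | source_p b =>
    obtain ⟨k, hk⟩ := h.blocker b rfl
    exact exists_moves_not_wins_of_edge id (.p_q b) h.inCopRegion ⟨.inr hk, trivial⟩
  | blocked_q _ _ hb => exact (Blocker.inCopRegion_of_mem_blocked hb).elim
  | station_forceT =>
    refine h.exists_moves_not_wins_force_value true id fun v hv => ?_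
    cases hv with
    | blocked_q _ _ hb => exact (Blocker.inCopRegion_of_mem_blocked hb).elim
    | forceT_barT x => exact ⟨id, x, .barT_T x⟩
  | station_forceF =>
    refine h.exists_moves_not_wins_force_value false id fun v hv => ?_
    cases hv with
    | blocked_q _ _ hb => exact (Blocker.inCopRegion_of_mem_blocked hb).elim
    | forceF_barF x => exact ⟨id, x, .barF_F x⟩
  | station_forceA _ hs => exact h.exists_moves_not_wins_forceA hs
  | station_forceA'' _ hs => exact h.exists_moves_not_wins_forceA'' hs
  | _ => exact (hu _ rfl).elim

end OnGuard

theorem Edge.not_inCopRegion_of_station (h : ℱ.Edge (.station s) u) : ¬ u.InCopRegion := by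
  cases h with
  | blocked_q _ _ hb => exact (Blocker.inCopRegion_of_mem_blocked hb).elim
  | _ => exact id

theorem Edge.station_station (h : ℱ.Edge (.station s) (.station t)) :
    t = s.next ∨ s = .RM ∧ ∃ y, t = .Sw y := by
  cases h with
  | RM_Sw y => exact .inr ⟨rfl, y, rfl⟩
  | _ => exact .inl rfl

variable {β : ℱ.Var → Bool} {c c' : Fin ℱ.FC.length → ℱ.Vertex}

theorem inCopRegion_representing (hc : ∀ ψ, (c ψ).InCopRegion) (k : ℱ.Role) :
    (representing β c k).InCopRegion := by
  cases k with
  | var x => exact inCopRegion_value ..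
  | clause ψ => exact hc ψ
  | commander => trivial

theorem inCopRegion_flipping (hc : ∀ ψ, (c ψ).InCopRegion) (k : ℱ.Role) :
    (flipping β x c k).InCopRegion := by
  cases k with
  | var z =>
    by_cases hz : z = x <;> simp [flipping, hz, inCopRegion_value, inCopRegion_half]
  | clause ψ => exact hc ψ
  | commander => trivial

theorem moves_self (hσ : ∀ k, (σ k).InCopRegion) : Moves σ σ := fun k => ⟨.inl rfl, hσ k⟩

theorem moves_representing (h : ∀ ψ, Step (c ψ) (c' ψ)) :
    Moves (representing β c) (representing β c')
  | .var _ => ⟨.inl rfl, inCopRegion_value ..⟩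
  | .clause ψ => h ψ
  | .commander => ⟨.inl rfl, trivial⟩

theorem moves_representing_flipping (hc : ∀ ψ, (c ψ).InCopRegion) (x : ℱ.Var) :
    Moves (representing β c) (flipping β x c) := by
  refine fun k => ⟨?_, inCopRegion_flipping hc k⟩
  cases k with
  | var z =>
    by_cases hz : z = x
    · subst hz
      simp only [flipping, representing, if_true]
      exact .inr (.value_half z (β z))
    · exact .inl (if_neg hz)
  | clause ψ => exact .inl rfl
  | commander => exact .inr (.HQ_G x)

theorem moves_flipping_representing (hc : ∀ ψ, (c ψ).InCopRegion) (x : ℱ.Var) :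
    Moves (flipping β x c) (representing (toggle β x) c) := by
  refine fun k => ⟨?_, inCopRegion_representing hc k⟩
  cases k with
  | var z =>
    by_cases hz : z = x
    · subst hz
      simp only [flipping, representing, if_true, toggle_self]
      exact .inr (.half_value z (β z))
    · simp only [flipping, representing, if_neg hz, toggle_of_ne hz]
      exact .inl rfl
  | clause ψ => exact .inl rfl
  | commander => exact .inr (.G_HQ x)

theorem not_winsI_II_of_not_winsI_I (h : ¬ ℱ.WinsI (.I, β)) (hFC : ¬ ℱ.Holds ℱ.FC β) :
    ¬ ℱ.WinsI (.II, β) ∧ ∀ y, ¬ ℱ.WinsI (.II, toggle β (.inr y)) :=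
  ⟨fun h' => h (.one β _ (move_I_iff.2 ⟨hFC, .inl rfl⟩) h'),
    fun y h' => h (.one β _ (move_I_iff.2 ⟨hFC, .inr ⟨y, rfl⟩⟩) h')⟩

theorem exists_move_of_not_winsI_II (h : ¬ ℱ.WinsI (.II, β)) :
    ∃ β', ℱ.Move (.II, β) (.I, β') ∧ ¬ ℱ.WinsI (.I, β') := by
  contrapose! h
  refine .two β fun q hq => ?_
  obtain ⟨_ | _, β'⟩ := q
  · exact h β' hq
  · nomatch hq

/-- The clause cops defend the vertices `a` and `a''`. -/
def Ready (c : Fin ℱ.FC.length → ℱ.Vertex) : Prop := ∀ ψ, c ψ = .a ψ ∨ c ψ = .a''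

theorem Ready.inCopRegion (hc : Ready c) (ψ : Fin ℱ.FC.length) : (c ψ).InCopRegion := by
  obtain h | h := hc ψ <;> rw [h] <;> trivial

/-- With Robber on the station `s` and the assignment `β`, the cops have reached `a''` or the
formula-satisfying game is not lost for player II. -/
def Favourable : ℱ.Station → (ℱ.Var → Bool) → (Fin ℱ.FC.length → ℱ.Vertex) → Prop
  | .RM, β, c | .CT, β, c => (¬ ℱ.WinsI (.I, β) ∧ ¬ ℱ.Holds ℱ.FC β) ∨ ∃ ψ, c ψ = .a''
  | .CM, β, c | .RW, β, c => ¬ ℱ.WinsI (.I, β) ∨ ∃ ψ, c ψ = .a''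
  | .RT, β, c | .Sw _, β, c => ¬ ℱ.WinsI (.II, β) ∨ ∃ ψ, c ψ = .a''

theorem exists_edge_robberGate (hc : Favourable .RT β c) (φ : Fin ℱ.FR.length) :
    ∃ k, ℱ.Edge (representing β c k) (.q (.robberGate φ)) := by
  obtain h | ⟨ψ, hψ⟩ := hc
  · obtain ⟨β', hm, -⟩ := exists_move_of_not_winsI_II h
    obtain ⟨l, hl, hlβ⟩ : ∃ l ∈ ℱ.FR.get φ, β l.1 ≠ l.2 := by
      by_contra! hφ
      exact (move_II_iff.1 hm).1 ⟨_, List.get_mem .., hφ⟩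
    exact ⟨.var l.1, .blocked_q _ _ ⟨l, hl, by rw [← Bool.eq_not.2 hlβ]; rfl⟩⟩
  · exact ⟨.clause ψ, by simpa [representing, hψ] using Edge.a''_z φ⟩

theorem onGuard_representing (hs : .HQ ∈ (Blocker.command s).blocked) (hc : Ready c)
    (h : Favourable s β c) : OnGuard s (representing β c) where
  inCopRegion := inCopRegion_representing hc.inCopRegion
  blocker b hb := by
    cases b with
    | robberGate φ => cases hb; exact exists_edge_robberGate h φ
    | copGate ψ i => exact ⟨.clause ψ, .blocked_q _ _ (.inr (hc ψ))⟩
    | robberSwitch y => cases hb; nomatch hs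
    | command t => cases hb; exact ⟨.commander, .blocked_q _ _ hs⟩
  value x := .inl ⟨_, rfl⟩
  clause _ := hc

theorem onGuard_flipping (hs : .G x ∈ (Blocker.command s).blocked) (hc : Ready c) :
    OnGuard s (flipping β x c) where
  inCopRegion := inCopRegion_flipping hc.inCopRegion
  blocker b hb := by
    cases b with
    | robberGate φ => cases hb; nomatch hs
    | copGate ψ i => cases hb; nomatch hs
    | robberSwitch y =>
      cases hb
      cases hs
      refine ⟨.var (.inr y), .blocked_q _ _ ?_⟩
      cases h : β (.inr y) <;> simp [flipping, Vertex.half, Blocker.blocked, h]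
    | command t => cases hb; exact ⟨.commander, .blocked_q _ _ hs⟩
  value z := by
    by_cases hz : z = x
    · exact .inr (hz ▸ rfl)
    · exact .inl ⟨β z, if_neg hz⟩
  clause _ := hc

theorem onGuard_leaving (h : ∀ l ∈ ℱ.FC.get ψ, β l.1 = l.2) :
    OnGuard .CT (representing β (Function.update .a ψ (.a' ψ))) where
  inCopRegion := inCopRegion_representing fun χ => by
    by_cases hχ : χ = ψ <;> simp [hχ, Vertex.InCopRegion]
  blocker b hb := by
    cases b with
    | robberGate φ => cases hb
    | copGate χ i =>
      rcases eq_or_ne χ ψ with rfl | hχ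
      · refine ⟨.var ((ℱ.FC.get χ).get i).1, .blocked_q _ _ (.inl ?_)⟩
        rw [← h _ (List.get_mem ..)]
        rfl
      · exact ⟨.clause χ, .blocked_q _ _ (.inr (.inl (Function.update_of_ne hχ ..)))⟩
    | robberSwitch y => cases hb
    | command t => cases hb; exact ⟨.commander, .blocked_q _ _ rfl⟩
  value x := .inl ⟨_, rfl⟩
  clause h := (h rfl).elim

/-- The formations in which the cops wait for Robber on the stations. -/
inductive Patrol : ℱ.Station → ℱ.Formation → Prop
  | representing {s : ℱ.Station} {β : ℱ.Var → Bool} {c : Fin ℱ.FC.length → ℱ.Vertex} :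
      .HQ ∈ (Blocker.command s).blocked → Ready c → Favourable s β c →
      Patrol s (representing β c)
  | flipping {s : ℱ.Station} {β : ℱ.Var → Bool} {x : ℱ.Var} {c : Fin ℱ.FC.length → ℱ.Vertex} :
      .G x ∈ (Blocker.command s).blocked → Ready c →
      Favourable s.next (toggle β x) c → Patrol s (flipping β x c)
  | leaving {β : ℱ.Var → Bool} {ψ : Fin ℱ.FC.length} : (∀ l ∈ ℱ.FC.get ψ, β l.1 = l.2) →
      Patrol .CT (representing β (Function.update .a ψ (.a' ψ)))

theorem Patrol.onGuard (h : Patrol s σ) : OnGuard s σ := by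
  cases h with
  | representing hs hc h => exact onGuard_representing hs hc h
  | flipping hs hc _ => exact onGuard_flipping hs hc
  | leaving h => exact onGuard_leaving h

theorem exists_patrol_CT (h : ¬ ℱ.WinsI (.I, β)) :
    ∃ σ', Moves (representing β .a) σ' ∧ Patrol .CT σ' := by
  by_cases hFC : ℱ.Holds ℱ.FC β
  · obtain ⟨φ, hφ, hβ⟩ := hFC
    obtain ⟨ψ, rfl⟩ := List.get_of_mem hφ
    refine ⟨_, moves_representing fun χ => ?_, .leaving hβ⟩
    rcases eq_or_ne χ ψ with rfl | hχ
    · rw [Function.update_self]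
      exact ⟨.inr (.a_a' χ), trivial⟩
    · rw [Function.update_of_ne hχ]
      exact ⟨.inl rfl, trivial⟩
  · exact ⟨_, moves_self (inCopRegion_representing fun _ => trivial),
      .representing rfl (fun _ => .inl rfl) (.inl ⟨h, hFC⟩)⟩

theorem exists_moves_patrol_of_representing (hs : .HQ ∈ (Blocker.command s).blocked)
    (hc : Ready c) (h : Favourable s β c) (hE : ℱ.Edge (.station s) (.station t)) :
    ∃ σ', Moves (representing β c) σ' ∧ Patrol t σ' := by
  have stay (ht : .HQ ∈ (Blocker.command t).blocked) (h' : Favourable t β c) :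
      ∃ σ', Moves (representing β c) σ' ∧ Patrol t σ' :=
    ⟨_, moves_self (inCopRegion_representing hc.inCopRegion), .representing ht hc h'⟩
  have flip (x : ℱ.Var) (ht : .G x ∈ (Blocker.command t).blocked)
      (h' : Favourable t.next (toggle β x) c) : ∃ σ', Moves (representing β c) σ' ∧ Patrol t σ' :=
    ⟨_, moves_representing_flipping hc.inCopRegion x, .flipping ht hc h'⟩
  cases hE with
  | RM_RT => exact stay rfl (h.imp_left fun h => (not_winsI_II_of_not_winsI_I h.1 h.2).1)
  | RM_Sw y =>
    exact flip (.inr y) rfl (h.imp_left fun h => (not_winsI_II_of_not_winsI_I h.1 h.2).2 y)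
  | RT_CM =>
    obtain h | ha'' := h
    · obtain ⟨β', hm, hβ'⟩ := exists_move_of_not_winsI_II h
      obtain ⟨-, rfl | ⟨x, rfl⟩⟩ := move_II_iff.1 hm
      · exact stay (.inl rfl) (.inl hβ')
      · exact flip (.inl x) (.inr ⟨x, rfl⟩) (.inl hβ')
    · exact stay (.inl rfl) (.inr ha'')
  | CM_RW => exact stay rfl h
  | RW_CT =>
    by_cases ha'' : ∃ ψ, c ψ = .a''
    · exact stay rfl (.inr ha'')
    · obtain rfl : c = .a :=
        funext fun ψ => (hc ψ).resolve_right fun hψ => ha'' ⟨ψ, hψ⟩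
      exact exists_patrol_CT (h.resolve_right ha'')
  | CT_RM => exact stay rfl h
  | Sw_RT y => nomatch hs

theorem exists_moves_patrol_of_flipping (hs : .G x ∈ (Blocker.command s).blocked)
    (hc : Ready c) (h : Favourable s.next (toggle β x) c)
    (hE : ℱ.Edge (.station s) (.station t)) :
    ∃ σ', Moves (flipping β x c) σ' ∧ Patrol t σ' := by
  obtain rfl | ⟨rfl, -⟩ := hE.station_station
  · refine ⟨_, moves_flipping_representing hc.inCopRegion x, .representing ?_ hc h⟩
    cases s <;> first | rfl | nomatch hs
  · nomatch hs

theorem exists_moves_patrol_of_leaving (ψ : Fin ℱ.FC.length)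
    (hE : ℱ.Edge (.station .CT) (.station t)) :
    ∃ σ', Moves (representing β (Function.update .a ψ (.a' ψ))) σ' ∧ Patrol t σ' := by
  obtain rfl | ⟨h, -⟩ := hE.station_station
  · refine ⟨representing β (Function.update .a ψ .a''), moves_representing fun χ => ?_,
      .representing rfl (fun χ => ?_) (.inr ⟨ψ, Function.update_self ..⟩)⟩
    all_goals rcases eq_or_ne χ ψ with rfl | hχ
    · simp only [Function.update_self]
      exact ⟨.inr (.a'_a'' χ), trivial⟩
    · simp only [Function.update_of_ne hχ]
      exact ⟨.inl rfl, trivial⟩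
    · exact .inr (Function.update_self ..)
    · exact .inl (Function.update_of_ne hχ ..)
  · nomatch h

theorem Patrol.exists_moves (h : Patrol s σ) (hE : ℱ.Edge (.station s) (.station t)) :
    ∃ σ', Moves σ σ' ∧ Patrol t σ' := by
  cases h with
  | representing hs hc h => exact exists_moves_patrol_of_representing hs hc h hE
  | flipping hs hc h => exact exists_moves_patrol_of_flipping hs hc h hE
  | leaving => exact exists_moves_patrol_of_leaving _ hE

theorem Patrol.not_wins (h : Patrol s σ) : ¬ Wins (.station s) σ := by
  refine GuardingGame.not_robberWinsAt_of_invariant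
    (fun u σ => ∃ s, u = .station s ∧ Patrol s σ) ?_ ?_ ?_ ⟨s, rfl, h⟩
  · rintro _ _ ⟨_, rfl, -⟩
    exact id
  · rintro _ _ ⟨_, rfl, h⟩
    exact h.onGuard.inCopRegion
  · rintro _ σ v ⟨s, rfl, h⟩ hE -
    refine ⟨Edge.not_inCopRegion_of_station hE, ?_⟩
    by_cases hv : ∃ t, v = .station t
    · obtain ⟨t, rfl⟩ := hv
      obtain ⟨σ', hm, ht⟩ := h.exists_moves hE
      exact ⟨σ', hm, .inl ⟨t, rfl, ht⟩⟩
    · obtain ⟨σ', hm, hL⟩ := h.onGuard.exists_moves_not_wins hE (not_exists.1 hv)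
      exact ⟨σ', hm, .inr hL⟩

theorem exists_moves_patrol_testStation {τ : Player} (h : ¬ ℱ.WinsI (τ, β)) :
    ∃ σ', Moves (representing β .a) σ' ∧ Patrol (testStation τ) σ' := by
  cases τ with
  | I => exact exists_patrol_CT h
  | II => exact ⟨_, moves_self (inCopRegion_representing fun _ => trivial),
      .representing rfl (fun _ => .inl rfl) (.inl h)⟩

theorem playerIWins_of_robberWins (h : ℱ.toGuardingGame.RobberWins) : ℱ.PlayerIWins := by
  by_contra hI
  refine GuardingGame.not_robberWinsAt_of_forall_adj id
    (inCopRegion_representing (c := .a) fun _ => trivial) (fun v hE _ => ?_) (robberWins_iff.1 h)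
  obtain rfl : v = .station (testStation ℱ.τ) := by
    cases hE with
    | start_CT h | start_RT h => rw [h]; rfl
    | blocked_q _ _ hb => exact (Blocker.inCopRegion_of_mem_blocked hb).elim
  obtain ⟨σ', hm, hσ'⟩ := exists_moves_patrol_testStation hI
  exact ⟨id, σ', hm, hσ'.not_wins⟩

end CopStrategy

end FormulaGame

/-! ### The size of the guarding game -/

theorem length_fixedBits (w k : ℕ) : (fixedBits w k).length = w := List.length_ofFn

theorem length_encodeListWith {α : Type} (enc : α → List Bool) (l : List α) :
    (encodeListWith enc l).length = (l.map fun a => (enc a).length).sum + l.length + 1 := by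
  simp [encodeListWith, List.length_flatMap, List.sum_map_add]

namespace GuardingGame

variable (𝒢 : GuardingGame)

open Classical in
theorem length_filter_adj {n : ℕ} (e : 𝒢.V ≃ Fin n) (i : Fin n) :
    ((List.finRange n).filter fun j => decide (𝒢.graph.Adj (e.symm i) (e.symm j))).length =
      𝒢.outDegree (e.symm i) := by
  rw [← List.toFinset_card_of_nodup ((List.nodup_finRange n).filter _), outDegree,
    ← Set.ncard_preimage_of_injective_subset_range e.symm.injective (by simp),
    ← Set.ncard_coe_finset]
  congr 1
  ext j
  simp

theorem length_encode (e : 𝒢.V ≃ Fin (Fintype.card 𝒢.V)) :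
    (𝒢.encode e).length = 3 * Fintype.card 𝒢.V + 1 +
      (𝒢.nameWidth + 1) * (∑ u, 𝒢.outDegree u + 𝒢.c + 1) := by
  rw [← e.symm.sum_comp 𝒢.outDegree]
  simp only [encode, List.length_append, length_encodeListWith, length_fixedBits,
    List.length_cons, length_filter_adj, List.map_const', List.sum_replicate,
    List.length_finRange, smul_eq_mul, ← Fin.sum_univ_def, Finset.sum_add_distrib,
    ← Finset.sum_mul, Finset.sum_const, Finset.card_univ, Fintype.card_fin]
  ring

theorem sum_outDegree_le (succ pred : 𝒢.V → List 𝒢.V) {a b : ℕ}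
    (hsucc : ∀ u, (succ u).length ≤ a) (hpred : ∀ v, (pred v).length ≤ b)
    (h : ∀ u v, 𝒢.graph.Adj u v → v ∈ succ u ∨ u ∈ pred v) :
    ∑ u, 𝒢.outDegree u ≤ (a + b) * Fintype.card 𝒢.V := by
  classical
  have card_filter_mem_le (l : List 𝒢.V) : (Finset.univ.filter (· ∈ l)).card ≤ l.length := by
    simpa [← List.mem_toFinset] using l.toFinset_card_le
  have outDegree_le u : 𝒢.outDegree u ≤
      (Finset.univ.filter (· ∈ succ u)).card + (Finset.univ.filter (u ∈ pred ·)).card := by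
    refine le_trans ?_ (Finset.card_union_le _ _)
    rw [← Set.ncard_coe_finset]
    exact Set.ncard_le_ncard fun v huv => by simpa using h u v huv
  calc ∑ u, 𝒢.outDegree u
    _ ≤ ∑ u, (Finset.univ.filter (· ∈ succ u)).card +
          ∑ u, (Finset.univ.filter (u ∈ pred ·)).card :=
        (Finset.sum_le_sum fun u _ => outDegree_le u).trans_eq Finset.sum_add_distrib
    _ = ∑ u, (Finset.univ.filter (· ∈ succ u)).card +
          ∑ v, (Finset.univ.filter (· ∈ pred v)).card :=
        congrArg _ (Finset.sum_card_bipartiteAbove_eq_sum_card_bipartiteBelow (· ∈ pred ·))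
    _ ≤ Fintype.card 𝒢.V * a + Fintype.card 𝒢.V * b :=
        add_le_add
          (Finset.sum_le_card_nsmul _ _ _ fun u _ => (card_filter_mem_le _).trans (hsucc u))
          (Finset.sum_le_card_nsmul _ _ _ fun v _ => (card_filter_mem_le _).trans (hpred v))
    _ = (a + b) * Fintype.card 𝒢.V := by ring

theorem length_encode_le (e : 𝒢.V ≃ Fin (Fintype.card 𝒢.V)) (hS : Function.Injective 𝒢.S)
    {d : ℕ} (hd : ∑ u, 𝒢.outDegree u ≤ d * Fintype.card 𝒢.V) :
    (𝒢.encode e).length ≤ (d + 6) * Fintype.card 𝒢.V * (𝒢.nameWidth + 1) := by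
  have hc : 𝒢.c ≤ Fintype.card 𝒢.V := by simpa using Fintype.card_le_of_injective _ hS
  have hV : 0 < Fintype.card 𝒢.V := Fintype.card_pos_iff.2 ⟨𝒢.r⟩
  rw [length_encode]
  calc 3 * Fintype.card 𝒢.V + 1 + (𝒢.nameWidth + 1) * (∑ u, 𝒢.outDegree u + 𝒢.c + 1)
    _ ≤ (3 * Fintype.card 𝒢.V + 1) * (𝒢.nameWidth + 1) +
          (d * Fintype.card 𝒢.V + Fintype.card 𝒢.V + 1) * (𝒢.nameWidth + 1) := by
        rw [mul_comm (𝒢.nameWidth + 1)]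
        gcongr
        exact Nat.le_mul_of_pos_right _ (Nat.succ_pos _)
    _ ≤ (d + 6) * Fintype.card 𝒢.V * (𝒢.nameWidth + 1) := by
        rw [← add_mul]
        gcongr
        linarith

end GuardingGame

namespace FormulaGame

variable (ℱ : FormulaGame)

theorem card_station : Fintype.card ℱ.Station = ℱ.nR + 5 := by
  simp only [← Fintype.card_congr (Station.proxyTypeEquiv ℱ), Fintype.card_sum,
    Fintype.card_unit, Fintype.card_fin]
  ring

theorem card_blocker : Fintype.card ℱ.Blocker =
    ℱ.FR.length + ∑ ψ, (ℱ.FC.get ψ).length + 2 * ℱ.nR + 5 := by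
  simp only [← Fintype.card_congr (Blocker.proxyTypeEquiv ℱ), Fintype.card_sum,
    Fintype.card_sigma, Fintype.card_fin, card_station]
  ring

theorem card_vertex : Fintype.card ℱ.Vertex =
    2 * (ℱ.FR.length + ∑ ψ, (ℱ.FC.get ψ).length) + 4 * ℱ.FC.length + 9 * ℱ.nC + 14 * ℱ.nR +
      23 := by
  simp only [← Fintype.card_congr (Vertex.proxyTypeEquiv ℱ), Fintype.card_sum,
    Fintype.card_unit, Fintype.card_fin, card_station, card_blocker]
  ring

theorem le_length_encode :
    ℱ.nC + ℱ.nR + ℱ.FR.length + ℱ.FC.length + 5 ≤ ℱ.encode.length := by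
  simp only [encode, List.length_cons, List.length_append, length_encodeListWith,
    List.length_finRange]
  omega

theorem card_vertex_le : Fintype.card ℱ.Vertex ≤ 28 * ℱ.encode.length := by
  have hFC : ∑ ψ, (ℱ.FC.get ψ).length ≤ 12 * ℱ.FC.length := by
    simpa [mul_comm] using
      Finset.sum_le_card_nsmul Finset.univ _ 12 fun ψ _ => ℱ.FC_le _ (List.get_mem _ ψ)
  have := ℱ.le_length_encode
  rw [card_vertex]
  omega

variable {ℱ}

/-- Endpoints of the edges from `u`, except for the edges listed by `shortPredecessors`. The lists
are bounded although neither the out-degrees nor the in-degrees are. -/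
def shortSuccessors : ℱ.Vertex → List ℱ.Vertex
  | .start => [.station .CT, .station .RT]
  | .station s => [.station s.next, .forceT, .forceF, .forceA, .forceA'']
  | .p b => [.q b]
  | .forceA'' => [.barA'']
  | .barT x => [.T x]
  | .barF x => [.F x]
  | .barA ψ => [.a ψ]
  | .barA'' => [.a'']
  | .T x => [.FT x]
  | .FT x => [.F x]
  | .F x => [.TF x]
  | .TF x => [.T x]
  | .a ψ => [.a' ψ]
  | .a' _ => [.a'']
  | .a''' ψ => [.a ψ]
  | .G x => [.HQ, .GT x, .GF x, .q (.command .CM)]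
  | .GT x => [.T x]
  | .GF x => [.F x]
  | _ => []

/-- Starting points of the edges into `v`, except for the edges listed by `shortSuccessors`. -/
def shortPredecessors : ℱ.Vertex → List ℱ.Vertex
  | .station _ => [.station .RM]
  | .p b => [.station b.source]
  | .q (.robberGate φ) => .a'' :: (ℱ.FR.get φ).map fun l => .value l.1 (!l.2)
  | .q (.copGate ψ i) =>
      [.value ((ℱ.FC.get ψ).get i).1 ((ℱ.FC.get ψ).get i).2, .a ψ, .a'']
  | .q (.robberSwitch y) => [.FT (.inr y), .TF (.inr y)]
  | .q (.command (.Sw y)) => [.G (.inr y)]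
  | .q (.command _) => [.HQ]
  | .barT _ => [.forceT]
  | .barF _ => [.forceF]
  | .barA _ => [.forceA]
  | .a''' _ => [.a'']
  | .G _ => [.HQ]
  | _ => []

theorem length_shortSuccessors_le (u : ℱ.Vertex) : (shortSuccessors u).length ≤ 5 := by
  cases u <;> simp [shortSuccessors]

theorem length_shortPredecessors_le (v : ℱ.Vertex) : (shortPredecessors v).length ≤ 13 := by
  cases v with
  | q b =>
    cases b with
    | robberGate φ => simpa [shortPredecessors, Nat.lt_succ_iff] using ℱ.FR_le _ (List.get_mem _ φ)
    | command s => cases s <;> simp [shortPredecessors]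
    | _ => simp [shortPredecessors]
  | _ => simp [shortPredecessors]

theorem Edge.mem_short {u v : ℱ.Vertex} (h : ℱ.Edge u v) :
    v ∈ shortSuccessors u ∨ u ∈ shortPredecessors v := by
  cases h with
  | blocked_q b _ hb =>
    cases b with
    | command s =>
      cases s <;> grind [Blocker.blocked, shortSuccessors, shortPredecessors]
    | _ => grind [Blocker.blocked, shortPredecessors]
  | _ => simp [shortSuccessors, shortPredecessors, Station.next]

theorem sum_outDegree_toGuardingGame_le :
    ∑ u, ℱ.toGuardingGame.outDegree u ≤ 18 * Fintype.card ℱ.toGuardingGame.V :=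
  ℱ.toGuardingGame.sum_outDegree_le shortSuccessors shortPredecessors length_shortSuccessors_le
    length_shortPredecessors_le fun _ _ => Edge.mem_short

end FormulaGame

theorem two_le_logb_two {L : ℝ} (hL : 4 ≤ L) : 2 ≤ Real.logb 2 L := by
  rw [Real.le_logb_iff_rpow_le one_lt_two (by linarith)]
  norm_num
  exact hL

theorem clog_two_add_one_le {N L : ℕ} (hL : 4 ≤ L) (hN : N ≤ 2 ^ 5 * L) :
    (Nat.clog 2 N + 1 : ℝ) ≤ 5 * Real.logb 2 L := by
  have hL' : (4 : ℝ) ≤ L := mod_cast hL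
  have hlog := two_le_logb_two hL'
  calc (Nat.clog 2 N + 1 : ℝ)
    _ ≤ Nat.clog 2 (2 ^ 5 * L) + 1 := by gcongr
    _ = ⌈Real.logb 2 (2 ^ 5 * L)⌉₊ + 1 := by
        rw [← Real.natCeil_logb_natCast]
        norm_num
    _ ≤ Real.logb 2 (2 ^ 5 * L) + 1 + 1 := by
        gcongr
        exact (Nat.ceil_lt_add_one (Real.logb_nonneg one_lt_two (by linarith))).le
    _ = Real.logb 2 L + 7 := by
        rw [Real.logb_mul (by positivity) (by positivity), Real.logb_pow,
          Real.logb_self_eq_one one_lt_two]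
        ring
    _ ≤ 5 * Real.logb 2 L := by linarith

namespace FormulaGame

theorem length_encode_toGuardingGame_le (ℱ : FormulaGame)
    (e : ℱ.toGuardingGame.V ≃ Fin (Fintype.card ℱ.toGuardingGame.V)) :
    ((ℱ.toGuardingGame.encode e).length : ℝ) ≤
      3360 * (ℱ.encode.length * Real.logb 2 ℱ.encode.length) := by
  have hV : Fintype.card ℱ.toGuardingGame.V ≤ 28 * ℱ.encode.length := ℱ.card_vertex_le
  have hlen := ℱ.toGuardingGame.length_encode_le e copStart_injective
    sum_outDegree_toGuardingGame_le
  have hwidth : (ℱ.toGuardingGame.nameWidth + 1 : ℝ) ≤ 5 * Real.logb 2 ℱ.encode.length :=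
    clog_two_add_one_le (by linarith [ℱ.le_length_encode]) (by omega)
  calc ((ℱ.toGuardingGame.encode e).length : ℝ)
    _ ≤ (18 + 6) * Fintype.card ℱ.toGuardingGame.V * (ℱ.toGuardingGame.nameWidth + 1) :=
        mod_cast hlen
    _ ≤ (18 + 6) * (28 * ℱ.encode.length) * (5 * Real.logb 2 ℱ.encode.length) := by
        gcongr
        exact_mod_cast hV
    _ = 3360 * (ℱ.encode.length * Real.logb 2 ℱ.encode.length) := by ring

theorem outDegree_eq_one_of_mem_border {ℱ : FormulaGame} {u : ℱ.toGuardingGame.V}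
    (hu : u ∈ ℱ.toGuardingGame.border) : ℱ.toGuardingGame.outDegree u = 1 := by
  obtain ⟨hu, v, hv, huv⟩ := hu
  exact Set.ncard_eq_one.2 ⟨v, Set.eq_singleton_iff_unique_mem.2
    ⟨huv, fun w hw => Edge.eq_of_border huv hu hv hw⟩⟩

theorem not_edge_start (ℱ : FormulaGame) (v : ℱ.Vertex) : ¬ ℱ.Edge v .start := nofun

end FormulaGame

theorem mainTheorem5 :
    ∃ K : ℝ, ∀ ℱ : FormulaGame,
      (ℱ.PlayerIWins ↔ ℱ.toGuardingGame.RobberWins) ∧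
      (∀ e : ℱ.toGuardingGame.V ≃ Fin (Fintype.card ℱ.toGuardingGame.V),
        ((ℱ.toGuardingGame.encode e).length : ℝ) ≤
          K * (ℱ.encode.length * Real.logb 2 ℱ.encode.length)) ∧
      (∀ v, ¬ ℱ.toGuardingGame.graph.Adj v ℱ.toGuardingGame.r) ∧
      Function.Injective ℱ.toGuardingGame.S ∧
      (∀ u ∈ ℱ.toGuardingGame.border, ℱ.toGuardingGame.outDegree u = 1) :=
  ⟨3360, fun ℱ =>
    ⟨⟨FormulaGame.robberWins_of_playerIWins, FormulaGame.playerIWins_of_robberWins⟩,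
      ℱ.length_encode_toGuardingGame_le, ℱ.not_edge_start, FormulaGame.copStart_injective,
      fun _ => FormulaGame.outDegree_eq_one_of_mem_border⟩⟩
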